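/- Call a real algebraic integer $\beta>1$ a Pisot number if every conjugate of $\beta$ over $\mathbb{Q}$ other than $\beta$ itself has absolute value less than $1$, and a Salem number if every conjugate of $\beta$ other than $\beta$ itself has absolute value at most $1$ and at least one conjugate has absolute value exactly $1$. Write $\mathbb{N}=\{0,1,2,\dots\}$. For an integer $k\ge 3$ let $\sigma_k$ be the unique zero of $G_k(X)=(1-X)^k+(k-1)X-1$ on the open interval $(0,1)$. For real $\rho>1$ put $$\gamma(\rho;X)=\sum_{m=0}^{\infty}X^{\lfloor m^{\rho}\rfloor}.$$ Let $\Theta=\{(y,z)\in\mathbb{R}^2 : y>0,\ \text{or}\ y=0\ \text{and}\ z>0\}$ and, for $(y,z)\in\Theta$ and real $R\ge 3$, put $$\varphi(y,z;R)=\exp\bigl((\log R)^{1+y}(\log\log R)^{z}\bigr),\qquad \xi(y,z;X)=1+\sum_{m=3}^{\infty}X^{\lfloor\varphi(y,z;m)\rfloor}.$$ Let $A$ be a positive integer and $\rho$ a real number such that $\rho>A$ if $A\le 3$, and $\rho>\sigma_A^{-1}$ if $A\ge 4$. Then the following hold. 1) For any real number $y>1$ and any Pisot or Salem number $\beta$,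 the numbers $$\gamma(\rho;\beta^{-1})^{k_1}\Bigl(\sum_{m=0}^{\infty}\beta^{-\lfloor y^m\rfloor}\Bigr)^{k_2}\qquad(k_1,k_2\in\mathbb{N},\ k_1\le A),$$ as a family indexed by the pairs $(k_1,k_2)$, are linearly independent over $\mathbb{Q}(\beta)$. 2) For any $(y,z)\in\Theta$ and any Pisot or Salem number $\beta$, the numbers $$\gamma(\rho;\beta^{-1})^{k_1}\,\xi(y,z;\beta^{-1})^{k_2}\qquad(k_1,k_2\in\mathbb{N},\ k_1\le A),$$ as a family indexed by the pairs $(k_1,k_2)$, are linearly independent over $\mathbb{Q}(\beta)$. -/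

import Mathlib

namespace LacunaryValues

/-- `β` is a Pisot number: a real algebraic integer `> 1` all of whose conjugates (in `ℂ`)
other than `β` itself have absolute value `< 1`. -/
def IsPisot (β : ℝ) : Prop :=
  IsIntegral ℤ β ∧ 1 < β ∧ ∀ z : ℂ, IsConjRoot ℚ (β : ℂ) z → z ≠ (β : ℂ) → ‖z‖ < 1

/-- `β` is a Salem number: a real algebraic integer `> 1` all of whose conjugates (in `ℂ`)
other than `β` itself have absolute value `≤ 1`, with at least one conjugate of absolute
value exactly `1`. -/
def IsSalem (β : ℝ) : Prop :=
  IsIntegral ℤ β ∧ 1 < β ∧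
    (∀ z : ℂ, IsConjRoot ℚ (β : ℂ) z → z ≠ (β : ℂ) → ‖z‖ ≤ 1) ∧
    ∃ z : ℂ, IsConjRoot ℚ (β : ℂ) z ∧ ‖z‖ = 1

/-- `γ(ρ; X) = ∑_{m ≥ 0} X ^ ⌊m ^ ρ⌋`. -/
noncomputable def gammaSeries (ρ X : ℝ) : ℝ :=
  ∑' m : ℕ, X ^ ⌊(m : ℝ) ^ ρ⌋₊

/-- The series `∑_{m ≥ 0} X ^ ⌊y ^ m⌋`. -/
noncomputable def lacunarySeries (y X : ℝ) : ℝ :=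
  ∑' m : ℕ, X ^ ⌊y ^ m⌋₊

/-- `Θ`: the pairs `(y, z)` of reals with `y > 0`, or `y = 0` and `z > 0`. -/
def Theta : Set (ℝ × ℝ) :=
  {p | 0 < p.1 ∨ (p.1 = 0 ∧ 0 < p.2)}

/-- `φ(y, z; R) = exp ((log R) ^ (1 + y) * (log log R) ^ z)`, used for `R ≥ 3`. -/
noncomputable def phi (y z R : ℝ) : ℝ :=
  Real.exp (Real.log R ^ (1 + y) * Real.log (Real.log R) ^ z)

/-- `ξ(y, z; X) = 1 + ∑_{m ≥ 3} X ^ ⌊φ(y, z; m)⌋` (the sum is reindexed by `m ↦ m + 3`). -/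
noncomputable def xiSeries (y z X : ℝ) : ℝ :=
  1 + ∑' m : ℕ, X ^ ⌊phi y z ((m + 3 : ℕ) : ℝ)⌋₊

/-- `G_k(x) = (1 - x) ^ k + (k - 1) x - 1`. -/
def G (k : ℕ) (x : ℝ) : ℝ :=
  (1 - x) ^ k + ((k : ℝ) - 1) * x - 1

/-- `σ_k`: for `k ≥ 3` the unique zero of `G_k` on the open interval `(0, 1)`;
see `sigma_spec` and `eq_sigma`. -/
noncomputable def sigma (k : ℕ) : ℝ :=
  sInf {x : ℝ | x ∈ Set.Ioo (0 : ℝ) 1 ∧ G k x = 0}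

/-- For `k ≥ 3` the function `G_k` has exactly one zero on `(0, 1)`. -/
theorem existsUnique_zero_G (k : ℕ) (hk : 3 ≤ k) :
    ∃! x : ℝ, x ∈ Set.Ioo (0 : ℝ) 1 ∧ G k x = 0 := by
  have hk' : (3 : ℝ) ≤ k := by exact_mod_cast hk
  have hcont : Continuous (G k) := by unfold G; fun_prop
  have hneg : G k (1 / (k : ℝ) ^ 2) < 0 := by
    set x : ℝ := 1 / (k : ℝ) ^ 2 with hx
    have hx0 : 0 < x := by positivity
    have hx1 : x * (k : ℝ) ^ 2 = 1 := by rw [hx]; field_simp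
    have hxle : x ≤ 1 := by nlinarith
    have hb : 1 + (k : ℝ) * x ≤ (1 + x) ^ k := one_add_mul_le_pow (by linarith) k
    have hprod : (1 - x) ^ k * (1 + x) ^ k ≤ 1 := by
      rw [← mul_pow]
      exact pow_le_one₀ (by nlinarith) (by nlinarith)
    have hp0 : 0 ≤ (1 - x) ^ k := pow_nonneg (by linarith) k
    have h1 : (1 - x) ^ k * (1 + k * x) ≤ 1 := by nlinarith
    have h2 : G k x * (1 + k * x) < 0 := by
      unfold G
      have h3 : (((k : ℝ) - 1) * x - 1) * (1 + k * x) = -1 - x + (k - 1) * x * (x * k) := by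
        ring
      have h4 : x * ((k - 1) * (x * k)) < x * 1 := by
        apply mul_lt_mul_of_pos_left _ hx0
        nlinarith
      nlinarith
    have h5 : 0 < 1 + (k : ℝ) * x := by positivity
    by_contra hcon
    have : 0 ≤ G k x * (1 + k * x) := mul_nonneg (not_lt.mp hcon) h5.le
    linarith
  have hpos : 0 < G k 1 := by
    have : k ≠ 0 := by omega
    simp only [G, sub_self, zero_pow this]
    linarith
  have hconv : StrictConvexOn ℝ (Set.Icc (0 : ℝ) 1) (G k) := by
    have hpow : StrictConvexOn ℝ (Set.Ici (0 : ℝ)) (fun x : ℝ => x ^ k) :=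
      strictConvexOn_pow (by omega)
    refine ⟨convex_Icc 0 1, ?_⟩
    intro x hx y hy hxy a b ha hb hab
    have h := hpow.2 (x := 1 - x) (y := 1 - y) (by simpa using hx.2) (by simpa using hy.2)
      (fun h => hxy (by linarith)) ha hb hab
    simp only [smul_eq_mul] at h ⊢
    have e : a * (1 - x) + b * (1 - y) = 1 - (a * x + b * y) := by
      linear_combination hab
    rw [e] at h
    unfold G
    have hb' : b = 1 - a := by linarith
    subst hb'
    nlinarith
  have hlt1 : 1 / (k : ℝ) ^ 2 < 1 := by
    rw [div_lt_one (by positivity)]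
    nlinarith
  have hgt0 : 0 < 1 / (k : ℝ) ^ 2 := by positivity
  obtain ⟨x, hx, hx0⟩ := intermediate_value_Ioo hlt1.le hcont.continuousOn ⟨hneg, hpos⟩
  have hG0 : G k 0 = 0 := by simp [G]
  -- between `0` and a zero in `(0, 1)` there is no further zero
  have key : ∀ a b : ℝ, 0 < a → a < b → b < 1 → G k a = 0 → G k b = 0 → False := by
    intro a b ha hab hb ha0 hb0
    have hbpos : 0 < b := ha.trans hab
    have hr : 0 < 1 - a / b := by
      rw [sub_pos, div_lt_one hbpos]
      exact hab
    have hq : 0 < a / b := by positivity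
    have h0 : (0 : ℝ) ∈ Set.Icc (0 : ℝ) 1 := ⟨le_rfl, zero_le_one⟩
    have h1 : b ∈ Set.Icc (0 : ℝ) 1 := ⟨hbpos.le, hb.le⟩
    have h := hconv.2 h0 h1 hbpos.ne hr hq (by ring)
    have e : (1 - a / b) • (0 : ℝ) + (a / b) • b = a := by
      simp only [smul_eq_mul]
      field_simp
      ring
    rw [e, hG0, hb0, ha0] at h
    simp at h
  refine ⟨x, ⟨⟨hgt0.trans hx.1, hx.2⟩, hx0⟩, ?_⟩
  rintro y ⟨hy, hy0⟩
  rcases lt_trichotomy x y with h | h | h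
  · exact (key x y (hgt0.trans hx.1) h hy.2 hx0 hy0).elim
  · exact h.symm
  · exact (key y x hy.1 h hx.2 hy0 hx0).elim

theorem eq_sigma (k : ℕ) (hk : 3 ≤ k) (x : ℝ) (hx : x ∈ Set.Ioo (0 : ℝ) 1)
    (hx0 : G k x = 0) : x = sigma k := by
  have h : {y : ℝ | y ∈ Set.Ioo (0 : ℝ) 1 ∧ G k y = 0} = {x} :=
    Set.eq_singleton_iff_unique_mem.mpr
      ⟨⟨hx, hx0⟩, fun y hy => (existsUnique_zero_G k hk).unique hy ⟨hx, hx0⟩⟩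
  rw [sigma, h, csInf_singleton]

theorem sigma_spec (k : ℕ) (hk : 3 ≤ k) :
    sigma k ∈ Set.Ioo (0 : ℝ) 1 ∧ G k (sigma k) = 0 := by
  obtain ⟨x, hx, -⟩ := existsUnique_zero_G k hk
  rw [← eq_sigma k hk x hx.1 hx.2]
  exact hx

end LacunaryValues

/-! ### Generating series of exponents: counting, supports, values -/

namespace LacunaryValues

open Filter Finset PowerSeries

/-! Put x = 1/ρ. Let F and G be the generating series of the exponents ⌊m^ρ⌋ and of the lacunary
sequence with 0 prepended, so that both supports contain 0. A linear dependence is a polynomial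
relation of degree at most A in γ(ρ; 1/β). After multiplication by suitable powers of the two
unknowns and clearing of denominators, it says that ∑ a_m β^(-m) = 0, where a = ∑ c_ij F^i G^j has
algebraic integer coefficients, degree exactly A in F, and an F^A-part of degree h ≥ 1 in G.

Arithmetic. The scaled partial sum Y_n = ∑_{m≤n} β^(n-m) a_m is minus a tail, so it grows at most
polynomially. So do its conjugates, because the other conjugates of β lie in the closed unit disc.
The norm of Y_n is a rational integer, so either Y_n = 0 or |Y_n| is at least an inverse power of n.
Since Y_(n+1) = β Y_n + a_(n+1), a run of N^δ zeros of a forces Y_n = 0 at its start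
(`exists_scaledSum_bounds`, `eq_zero_of_gap`).

Combinatorics. Let W, Q, V be the supports of F^(A-1) G^J, F^A G^(h-1), F^A G^h, with J bounding
every degree in G. Off W ∪ Q one has a_m = c_Ah · coeff m (F^A G^h): all these terms carry the same
sign pattern and cannot cancel. Up to N, the set W has O(N^((A-1)x+δ)) elements, and Q and V have
O(N^(Ax+δ)). Greedy approximation shows that the gaps in the support of F^A, hence in W ∪ Q, are
O(N^g) with g = (1-x)^A. Consider a gap of W ∪ Q starting at a ∈ Q. Some exponent t of G is
comparable to the gap and at most half of it, and a + t ∈ V. A stretch of N^δ integers before a + t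
without elements of V would make Y vanish there; the term at a + t would then grow uncancelled to
the end of the gap and break the polynomial bound. So the length of the gap is O(N^δ) times one plus
the number of elements of V in it (`gap_le_of_scaled_bounds`).

Summing the gaps up to N, those after W contribute O(N^((A-1)x+g+δ)) and the others O(N^(Ax+2δ)).
Both are o(N) as soon as Ax < 1 and (A-1)x + (1-x)^A < 1, which is what the hypothesis on ρ provides
(`exponent_conditions`), and this is absurd (`false_of_scaled_bounds`). -/

/-- The generating series of a sequence of exponents: `∑ m, X ^ s m`, for `s` with finite fibres. -/
noncomputable def countSeries (s : ℕ → ℕ) : PowerSeries ℕ :=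
  PowerSeries.mk fun n => Nat.card {m // s m = n}

/-- The sum of the coefficients of `F` up to `N` is `O((N + 1) ^ e)`. -/
def GrowthLE (F : PowerSeries ℕ) (e : ℝ) : Prop :=
  ∃ C : ℝ, ∀ N : ℕ, ((∑ n ∈ range (N + 1), coeff n F : ℕ) : ℝ) ≤ C * ((N : ℝ) + 1) ^ e

/-- The series `F`, evaluated at the real number `x`, converges to `v`. -/
def HasValue (F : PowerSeries ℕ) (x v : ℝ) : Prop :=
  HasSum (fun n => ((coeff n F : ℕ) : ℝ) * x ^ n) v

/-- Pairs of exponents with sum at most N lie in the square of side N, and all coefficients are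
nonnegative. -/
theorem sum_coeff_mul_le (F G : PowerSeries ℕ) (N : ℕ) :
    ∑ n ∈ range (N + 1), coeff n (F * G) ≤
      (∑ n ∈ range (N + 1), coeff n F) * ∑ n ∈ range (N + 1), coeff n G := by
  rw [sum_mul_sum, ← sum_product']
  simp only [coeff_mul]
  rw [sum_sigma']
  rw [← sum_image (f := fun p : ℕ × ℕ => coeff p.1 F * coeff p.2 G)
    (g := fun p : (_ : ℕ) × ℕ × ℕ => p.2)]
  · refine sum_le_sum_of_subset fun p hp => ?_
    obtain ⟨⟨n, a, b⟩, h, rfl⟩ := mem_image.mp hp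
    simp only [mem_sigma, mem_range, HasAntidiagonal.mem_antidiagonal, mem_product] at h ⊢
    omega
  · rintro ⟨n, a, b⟩ h ⟨n', a', b'⟩ h' he
    simp only [coe_sigma, Set.mem_sigma_iff, mem_coe, mem_range, HasAntidiagonal.mem_antidiagonal,
      Prod.mk.injEq] at h h' he
    obtain ⟨rfl, rfl⟩ := he
    obtain rfl : n = n' := by omega
    rfl

theorem GrowthLE.mul {F G : PowerSeries ℕ} {e e' : ℝ} (hF : GrowthLE F e) (hG : GrowthLE G e') :
    GrowthLE (F * G) (e + e') := by
  obtain ⟨C, hC⟩ := hF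
  obtain ⟨D, hD⟩ := hG
  refine ⟨C * D, fun N => ?_⟩
  have hN : (0 : ℝ) < (N : ℝ) + 1 := by positivity
  calc ((∑ n ∈ range (N + 1), coeff n (F * G) : ℕ) : ℝ)
      ≤ ((∑ n ∈ range (N + 1), coeff n F : ℕ) : ℝ) * ((∑ n ∈ range (N + 1), coeff n G : ℕ) : ℝ) := by
        exact_mod_cast sum_coeff_mul_le F G N
    _ ≤ (C * ((N : ℝ) + 1) ^ e) * (D * ((N : ℝ) + 1) ^ e') :=
        mul_le_mul (hC N) (hD N) (Nat.cast_nonneg _) ((Nat.cast_nonneg _).trans (hC N))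
    _ = C * D * ((N : ℝ) + 1) ^ (e + e') := by rw [Real.rpow_add hN]; ring

theorem GrowthLE.mono {F : PowerSeries ℕ} {e e' : ℝ} (hF : GrowthLE F e) (h : e ≤ e') :
    GrowthLE F e' := by
  obtain ⟨C, hC⟩ := hF
  refine ⟨C, fun N => (hC N).trans ?_⟩
  have hN : (0 : ℝ) < (N : ℝ) + 1 := by positivity
  have h0 : 0 ≤ C := by
    have := (Nat.cast_nonneg _).trans (hC N)
    exact nonneg_of_mul_nonneg_left this (by positivity)
  gcongr
  linarith [Nat.cast_nonneg (α := ℝ) N]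

theorem growthLE_one : GrowthLE 1 0 := by
  refine ⟨1, fun N => ?_⟩
  simp [coeff_one]

theorem GrowthLE.pow {F : PowerSeries ℕ} {e : ℝ} (hF : GrowthLE F e) (k : ℕ) :
    GrowthLE (F ^ k) (k * e) := by
  induction k with
  | zero => simpa using growthLE_one
  | succ k ih =>
    rw [pow_succ]
    convert ih.mul hF using 1
    push_cast
    ring

theorem GrowthLE.coeff_le {F : PowerSeries ℕ} {e C : ℝ}
    (hC : ∀ N : ℕ, ((∑ n ∈ range (N + 1), coeff n F : ℕ) : ℝ) ≤ C * ((N : ℝ) + 1) ^ e) (n : ℕ) :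
    ((coeff n F : ℕ) : ℝ) ≤ C * ((n : ℝ) + 1) ^ e := by
  refine le_trans ?_ (hC n)
  exact_mod_cast single_le_sum (f := fun n => coeff n F) (fun _ _ => Nat.zero_le _)
    (self_mem_range_succ n)

theorem card_filter_coeff_ne_zero_le (F : PowerSeries ℕ) (N : ℕ) :
    #{n ∈ range N | coeff n F ≠ 0} ≤ ∑ n ∈ range N, coeff n F := by
  rw [card_filter]
  refine sum_le_sum fun n _ => ?_
  split_ifs with h
  · exact Nat.one_le_iff_ne_zero.mpr h
  · exact Nat.zero_le _

theorem coeff_add_mul_ne_zero {F G : PowerSeries ℕ} {a b : ℕ} (ha : coeff a F ≠ 0)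
    (hb : coeff b G ≠ 0) : coeff (a + b) (F * G) ≠ 0 := by
  rw [coeff_mul]
  have : coeff a F * coeff b G ≤ ∑ p ∈ antidiagonal (a + b), coeff p.1 F * coeff p.2 G :=
    single_le_sum (f := fun p : ℕ × ℕ => coeff p.1 F * coeff p.2 G) (fun _ _ => Nat.zero_le _)
      (by simp : (a, b) ∈ antidiagonal (a + b))
  have h0 : 0 < coeff a F * coeff b G := Nat.pos_of_ne_zero (mul_ne_zero ha hb)
  omega

theorem coeff_pow_ne_zero_of_le {F : PowerSeries ℕ} (h0 : coeff 0 F ≠ 0) {i j : ℕ} (hij : i ≤ j)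
    {n : ℕ} (h : coeff n (F ^ i) ≠ 0) : coeff n (F ^ j) ≠ 0 := by
  induction j, hij using Nat.le_induction with
  | base => exact h
  | succ j _ ih => rw [pow_succ]; exact coeff_add_mul_ne_zero (b := 0) ih h0

theorem coeff_mul_ne_zero_mono {F F' G G' : PowerSeries ℕ}
    (hF : ∀ n, coeff n F ≠ 0 → coeff n F' ≠ 0) (hG : ∀ n, coeff n G ≠ 0 → coeff n G' ≠ 0) {n : ℕ}
    (h : coeff n (F * G) ≠ 0) : coeff n (F' * G') ≠ 0 := by
  rw [coeff_mul] at h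
  obtain ⟨p, hp, hne⟩ := exists_ne_zero_of_sum_ne_zero h
  rw [HasAntidiagonal.mem_antidiagonal] at hp
  rw [← hp]
  exact coeff_add_mul_ne_zero (hF _ (left_ne_zero_of_mul hne)) (hG _ (right_ne_zero_of_mul hne))

/-- The exponent 0 can be used for every additional factor, and natural coefficients never cancel,
so supports increase with the powers. -/
theorem coeff_pow_mul_pow_ne_zero_of_le {F G : PowerSeries ℕ} (hF : coeff 0 F ≠ 0)
    (hG : coeff 0 G ≠ 0) {i j i' j' : ℕ} (hi : i ≤ i') (hj : j ≤ j') {n : ℕ}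
    (h : coeff n (F ^ i * G ^ j) ≠ 0) : coeff n (F ^ i' * G ^ j') ≠ 0 :=
  coeff_mul_ne_zero_mono (fun _ => coeff_pow_ne_zero_of_le hF hi)
    (fun _ => coeff_pow_ne_zero_of_le hG hj) h

section countSeries

variable {s : ℕ → ℕ}

theorem finite_fiber (hs : Tendsto s atTop atTop) (n : ℕ) : Finite {m // s m = n} := by
  obtain ⟨B, hB⟩ := (hs.eventually_gt_atTop n).exists_forall_of_atTop
  refine Set.Finite.subset (Set.finite_lt_nat B) fun m hm => ?_
  by_contra h
  have h1 := hB m (not_lt.mp h)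
  have h2 : s m = n := hm
  omega

theorem coeff_countSeries_ne_zero (hs : Tendsto s atTop atTop) (m : ℕ) :
    coeff (s m) (countSeries s) ≠ 0 := by
  have := finite_fiber hs (s m)
  have : Nonempty {k // s k = s m} := ⟨⟨m, rfl⟩⟩
  rw [countSeries, coeff_mk]
  exact Nat.card_pos.ne'

theorem sum_coeff_countSeries_le {N B : ℕ}
    (hB : ∀ m, s m < N → m < B) : ∑ n ∈ range N, coeff n (countSeries s) ≤ B := by
  have h : ∀ n ∈ range N, coeff n (countSeries s) = #{m ∈ range B | s m = n} := by
    intro n hn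
    rw [countSeries, coeff_mk, ← Nat.card_eq_finsetCard]
    refine Nat.card_congr (Equiv.subtypeEquivRight fun m => ?_)
    rw [mem_filter, mem_range]
    rw [mem_range] at hn
    exact ⟨fun hm => ⟨hB m (hm ▸ hn), hm⟩, fun hm => hm.2⟩
  rw [sum_congr rfl h, ← card_biUnion]
  · exact (card_le_card (biUnion_subset.mpr fun n _ => filter_subset _ _)).trans_eq (card_range B)
  · intro n _ n' _ hne
    refine disjoint_filter.mpr fun m _ h1 h2 => hne (h1.symm.trans h2)

/-- The sum over indices is regrouped along the finite fibres of `s`. -/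
theorem hasValue_countSeries (hs : Tendsto s atTop atTop) {x : ℝ}
    (hx : Summable fun m => x ^ s m) : HasValue (countSeries s) x (∑' m, x ^ s m) := by
  have h := (Equiv.sigmaFiberEquiv s).hasSum_iff.mpr hx.hasSum
  refine h.sigma fun n => ?_
  have := finite_fiber hs n
  have := Fintype.ofFinite {m // s m = n}
  have hc : coeff n (countSeries s) = Fintype.card {m // s m = n} := by
    rw [countSeries, coeff_mk, Nat.card_eq_fintype_card]
  have hf := hasSum_fintype fun c : {m // s m = n} => x ^ s c.1
  rw [sum_congr rfl (g := fun _ => x ^ n) fun c _ => by rw [c.2], sum_const, card_univ,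
    nsmul_eq_mul, ← hc] at hf
  exact hf

end countSeries

theorem hasValue_one (x : ℝ) : HasValue 1 x 1 := by
  have h : ∀ n, ((coeff n (1 : PowerSeries ℕ) : ℕ) : ℝ) * x ^ n = if n = 0 then 1 else 0 := by
    intro n
    rw [coeff_one]
    split_ifs with h <;> simp [h]
  rw [HasValue, funext h]
  exact hasSum_ite_eq (0 : ℕ) (1 : ℝ)

theorem HasValue.mul {F G : PowerSeries ℕ} {x v w : ℝ} (hF : HasValue F x v)
    (hG : HasValue G x w) : HasValue (F * G) x (v * w) := by
  have hF' : Summable fun n => ‖((coeff n F : ℕ) : ℝ) * x ^ n‖ := hF.summable.norm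
  have hG' : Summable fun n => ‖((coeff n G : ℕ) : ℝ) * x ^ n‖ := hG.summable.norm
  have h1 := tsum_mul_tsum_eq_tsum_sum_antidiagonal_of_summable_norm hF' hG'
  have h2 := (summable_norm_sum_mul_antidiagonal_of_summable_norm hF' hG').of_norm.hasSum
  rw [← h1, hF.tsum_eq, hG.tsum_eq] at h2
  have hc : ∀ n, ((coeff n (F * G) : ℕ) : ℝ) * x ^ n =
      ∑ p ∈ HasAntidiagonal.antidiagonal n, ((coeff p.1 F : ℕ) : ℝ) * x ^ p.1 *
        (((coeff p.2 G : ℕ) : ℝ) * x ^ p.2) := by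
    intro n
    rw [coeff_mul]
    push_cast
    rw [sum_mul]
    refine sum_congr rfl fun p hp => ?_
    rw [← HasAntidiagonal.mem_antidiagonal.mp hp, pow_add]
    ring
  rw [HasValue, funext hc]
  exact h2

theorem HasValue.pow {F : PowerSeries ℕ} {x v : ℝ} (hF : HasValue F x v) (k : ℕ) :
    HasValue (F ^ k) x (v ^ k) := by
  induction k with
  | zero => simpa using hasValue_one x
  | succ k ih => rw [pow_succ, pow_succ]; exact ih.mul hF

end LacunaryValues

/-! ### Arithmetic of scaled partial sums in ℚ(β) -/

namespace LacunaryValues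

open Filter Finset

section Arithmetic

variable {β : ℝ}

/-- The inclusion `ℚ(β) ⊆ ℝ ⊆ ℂ`. -/
noncomputable def realEmbedding (β : ℝ) : IntermediateField.adjoin ℚ {β} →ₐ[ℚ] ℂ :=
  (Complex.ofRealAm.restrictScalars ℚ).comp (IntermediateField.adjoin ℚ {β}).val

theorem realEmbedding_apply (y : IntermediateField.adjoin ℚ {β}) :
    realEmbedding β y = ((y : ℝ) : ℂ) := rfl

theorem norm_realEmbedding (y : IntermediateField.adjoin ℚ {β}) :
    ‖realEmbedding β y‖ = |(y : ℝ)| := by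
  rw [realEmbedding_apply, Complex.norm_real, Real.norm_eq_abs]

theorem one_lt_of_isPisot_or_isSalem (hβ : IsPisot β ∨ IsSalem β) : 1 < β :=
  hβ.elim (fun h => h.2.1) fun h => h.2.1

theorem isIntegral_of_isPisot_or_isSalem (hβ : IsPisot β ∨ IsSalem β) : IsIntegral ℤ β :=
  hβ.elim (fun h => h.1) fun h => h.1

/-- An embedding is determined by the image of β, so any embedding but the standard one sends β to
another conjugate. -/
theorem norm_algHom_gen_le (hβ : IsPisot β ∨ IsSalem β)
    {σ : IntermediateField.adjoin ℚ {β} →ₐ[ℚ] ℂ} (hσ : σ ≠ realEmbedding β) :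
    ‖σ (IntermediateField.AdjoinSimple.gen ℚ β)‖ ≤ 1 := by
  have hconj : IsConjRoot ℚ (β : ℂ) (σ (IntermediateField.AdjoinSimple.gen ℚ β)) := by
    rw [isConjRoot_def, minpoly.algHom_eq σ σ.injective]
    exact minpoly.algHom_eq (realEmbedding β) (realEmbedding β).injective
      (IntermediateField.AdjoinSimple.gen ℚ β)
  have hne : σ (IntermediateField.AdjoinSimple.gen ℚ β) ≠ (β : ℂ) := by
    intro h
    apply hσ
    have hint : IsIntegral ℚ β := (isIntegral_of_isPisot_or_isSalem hβ).tower_top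
    apply (IntermediateField.adjoin.powerBasis hint).algHom_ext
    exact h
  rcases hβ with h | h
  · exact (h.2.2 _ hconj hne).le
  · exact h.2.2.1 _ hconj hne

theorem finiteDimensional_adjoin (hβ : IsIntegral ℤ β) :
    FiniteDimensional ℚ (IntermediateField.adjoin ℚ {β}) :=
  IntermediateField.adjoin.finiteDimensional hβ.tower_top

/-- The norm of a nonzero algebraic integer is a nonzero rational integer; it is the product of all
embeddings, of which one is the real absolute value. -/
theorem one_le_abs_mul_pow [FiniteDimensional ℚ (IntermediateField.adjoin ℚ {β})]
    {y : IntermediateField.adjoin ℚ {β}} (hy : IsIntegral ℤ y)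
    (hy0 : y ≠ 0) {B : ℝ} (hB : 1 ≤ B)
    (h : ∀ σ : IntermediateField.adjoin ℚ {β} →ₐ[ℚ] ℂ, σ ≠ realEmbedding β → ‖σ y‖ ≤ B) :
    1 ≤ |(y : ℝ)| * B ^ Fintype.card (IntermediateField.adjoin ℚ {β} →ₐ[ℚ] ℂ) := by
  classical
  have hprod := Algebra.norm_eq_prod_embeddings ℚ ℂ y
  obtain ⟨k, hk⟩ := IsIntegrallyClosed.isIntegral_iff.mp (Algebra.isIntegral_norm ℚ hy)
  have hk0 : k ≠ 0 := by
    rintro rfl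
    rw [map_zero] at hk
    exact hy0 (Algebra.norm_eq_zero_iff.mp hk.symm)
  have h1 : 1 ≤ ‖∏ σ : IntermediateField.adjoin ℚ {β} →ₐ[ℚ] ℂ, σ y‖ := by
    rw [← hprod, ← hk]
    simp only [eq_intCast, map_intCast, Complex.norm_intCast]
    exact_mod_cast Int.one_le_abs hk0
  rw [norm_prod, ← mul_prod_erase univ _ (mem_univ (realEmbedding β)), norm_realEmbedding] at h1
  refine h1.trans (mul_le_mul_of_nonneg_left ?_ (abs_nonneg _))
  calc ∏ σ ∈ univ.erase (realEmbedding β), ‖σ y‖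
      ≤ ∏ σ ∈ univ.erase (realEmbedding β), B :=
        prod_le_prod (fun _ _ => norm_nonneg _) fun σ hσ => h σ (ne_of_mem_erase hσ)
    _ ≤ B ^ Fintype.card (IntermediateField.adjoin ℚ {β} →ₐ[ℚ] ℂ) := by
        rw [prod_const]
        exact pow_le_pow_right₀ hB (card_le_univ _)

/-- The scaled partial sums `∑ m ≤ n, β ^ (n - m) * a m`. -/
noncomputable def scaledSum {K : Type*} [Semiring K] (b : K) (a : ℕ → K) (n : ℕ) : K :=
  ∑ m ∈ range (n + 1), b ^ (n - m) * a m

theorem scaledSum_succ {K : Type*} [Semiring K] (b : K) (a : ℕ → K) (n : ℕ) :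
    scaledSum b a (n + 1) = b * scaledSum b a n + a (n + 1) := by
  rw [scaledSum, sum_range_succ, scaledSum, mul_sum, Nat.sub_self, pow_zero, one_mul]
  congr 1
  refine sum_congr rfl fun m hm => ?_
  rw [← mul_assoc, ← pow_succ', Nat.succ_sub (Nat.lt_succ_iff.mp (mem_range.mp hm))]

theorem scaledSum_eq_zero_sub_tsum (hβ : 1 < β) {a : ℕ → ℝ}
    (h : HasSum (fun m => a m * β⁻¹ ^ m) 0) (n : ℕ) :
    scaledSum β a n = - ∑' m, a (m + (n + 1)) * β⁻¹ ^ (m + 1) := by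
  have hβ0 : β ≠ 0 := by positivity
  have h1 := h.summable.sum_add_tsum_nat_add (n + 1)
  rw [h.tsum_eq] at h1
  have h2 : scaledSum β a n = β ^ n * ∑ m ∈ range (n + 1), a m * β⁻¹ ^ m := by
    rw [scaledSum, mul_sum]
    refine sum_congr rfl fun m hm => ?_
    have hm' : m ≤ n := Nat.lt_succ_iff.mp (mem_range.mp hm)
    rw [pow_sub₀ _ hβ0 hm', inv_pow]
    ring
  have h3 : ∑' m, a (m + (n + 1)) * β⁻¹ ^ (m + 1) =
      β ^ n * ∑' m, a (m + (n + 1)) * β⁻¹ ^ (m + (n + 1)) := by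
    rw [← tsum_mul_left]
    congr 1
    ext m
    rw [pow_add β⁻¹ m (n + 1), pow_succ β⁻¹ n, inv_pow β n, pow_succ]
    field_simp
  rw [h2, h3]
  linear_combination β ^ n * h1

/-- The vanishing of the whole sum turns the partial sum into a tail; there (m + n + 2) ≤ (n + 1)(m
+ 2) separates the growth in n from a convergent series in m. -/
theorem exists_abs_scaledSum_le (hβ : 1 < β) {a : ℕ → ℝ}
    (h : HasSum (fun m => a m * β⁻¹ ^ m) 0) {C : ℝ} {E : ℕ}
    (ha : ∀ m, |a m| ≤ C * ((m : ℝ) + 1) ^ E) :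
    ∃ C' : ℝ, ∀ n, |scaledSum β a n| ≤ C' * ((n : ℝ) + 1) ^ E := by
  have hC : 0 ≤ C := by simpa using (abs_nonneg _).trans (ha 0)
  have hβi : 0 < β⁻¹ := by positivity
  have hβ1 : ‖β⁻¹‖ < 1 := by
    rw [Real.norm_of_nonneg hβi.le]
    exact inv_lt_one_of_one_lt₀ hβ
  have hsum : Summable fun m : ℕ => ((m : ℝ) + 2) ^ E * β⁻¹ ^ m := by
    have h1 := (summable_nat_add_iff (f := fun m : ℕ => (m : ℝ) ^ E * β⁻¹ ^ m) 2).mpr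
      (summable_pow_mul_geometric_of_norm_lt_one E hβ1)
    refine (h1.mul_right (β ^ 2)).congr fun m => ?_
    push_cast
    rw [pow_add, inv_pow β 2]
    field_simp
  refine ⟨C * ∑' m : ℕ, ((m : ℝ) + 2) ^ E * β⁻¹ ^ m, fun n => ?_⟩
  rw [scaledSum_eq_zero_sub_tsum hβ h, abs_neg]
  have hle : ∀ m : ℕ, ‖a (m + (n + 1)) * β⁻¹ ^ (m + 1)‖ ≤
      C * ((n : ℝ) + 1) ^ E * (((m : ℝ) + 2) ^ E * β⁻¹ ^ m) := by
    intro m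
    rw [norm_mul, Real.norm_eq_abs, Real.norm_of_nonneg (by positivity)]
    have h2 : |a (m + (n + 1))| ≤ C * (((n : ℝ) + 1) ^ E * ((m : ℝ) + 2) ^ E) := by
      refine (ha _).trans (mul_le_mul_of_nonneg_left ?_ hC)
      rw [← mul_pow]
      refine pow_le_pow_left₀ (by positivity) ?_ E
      push_cast
      have hn : (0 : ℝ) ≤ n := Nat.cast_nonneg n
      have hnm : (0 : ℝ) ≤ (n : ℝ) * m := by positivity
      linarith
    have h3 : β⁻¹ ^ (m + 1) ≤ β⁻¹ ^ m :=
      pow_le_pow_of_le_one hβi.le (inv_le_one_of_one_le₀ hβ.le) (Nat.le_succ m)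
    calc |a (m + (n + 1))| * β⁻¹ ^ (m + 1)
        ≤ C * (((n : ℝ) + 1) ^ E * ((m : ℝ) + 2) ^ E) * β⁻¹ ^ m :=
          mul_le_mul h2 h3 (by positivity) (by positivity)
      _ = _ := by ring
  have h4 := tsum_of_norm_bounded ((hsum.mul_left (C * ((n : ℝ) + 1) ^ E)).hasSum) hle
  rw [tsum_mul_left] at h4
  rw [← Real.norm_eq_abs]
  linarith

/-- A relation `∑ a m * β ^ (-m) = 0` with coefficients of polynomial growth that are algebraic
integers of `ℚ(β)`: the scaled partial sums vanish or are not much smaller than `1`. -/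
theorem exists_scaledSum_bounds (hβ : IsPisot β ∨ IsSalem β)
    {a : ℕ → IntermediateField.adjoin ℚ {β}} (hint : ∀ m, IsIntegral ℤ (a m)) {C : ℝ} {E : ℕ}
    (ha : ∀ (σ : IntermediateField.adjoin ℚ {β} →ₐ[ℚ] ℂ) (m : ℕ),
      ‖σ (a m)‖ ≤ C * ((m : ℝ) + 1) ^ E)
    (h : HasSum (fun m => (a m : ℝ) * β⁻¹ ^ m) 0) :
    ∃ (D : ℝ) (k : ℕ), 0 < D ∧ ∀ n, |scaledSum β (fun m => (a m : ℝ)) n| ≤ D * ((n : ℝ) + 1) ^ k ∧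
      (scaledSum β (fun m => (a m : ℝ)) n ≠ 0 →
        1 ≤ |scaledSum β (fun m => (a m : ℝ)) n| * (D * ((n : ℝ) + 1) ^ k)) := by
  have := finiteDimensional_adjoin (isIntegral_of_isPisot_or_isSalem hβ)
  have hβ1 := one_lt_of_isPisot_or_isSalem hβ
  obtain ⟨C', hC'⟩ := exists_abs_scaledSum_le hβ1 h (C := C) (E := E) fun m => by
    rw [← norm_realEmbedding]; exact ha _ m
  set d := Fintype.card (IntermediateField.adjoin ℚ {β} →ₐ[ℚ] ℂ) with hd
  set g := IntermediateField.AdjoinSimple.gen ℚ β with hg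
  have hC : 0 ≤ C := by simpa using (norm_nonneg _).trans (ha (realEmbedding β) 0)
  have hY : ∀ n, scaledSum β (fun m => (a m : ℝ)) n = ((scaledSum g a n : _) : ℝ) := by
    intro n
    simp only [scaledSum]
    push_cast
    rfl
  have hYint : ∀ n, IsIntegral ℤ (scaledSum g a n) := by
    intro n
    have hgint : IsIntegral ℤ g := by
      have := isIntegral_of_isPisot_or_isSalem hβ
      exact (isIntegral_algHom_iff ((IntermediateField.adjoin ℚ {β}).val.restrictScalars ℤ)
        Subtype.val_injective).mp this
    exact IsIntegral.sum _ fun m _ => (hgint.pow _).mul (hint m)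
  set B : ℕ → ℝ := fun n => (C + 1) * ((n : ℝ) + 1) ^ (E + 1) with hB
  have hB1 : ∀ n, 1 ≤ B n := fun n =>
    one_le_mul_of_one_le_of_one_le (by linarith)
      (one_le_pow₀ (by linarith [Nat.cast_nonneg (α := ℝ) n]))
  -- Since ‖σ g‖ ≤ 1, the powers of the generator do not enlarge the n + 1 summands.
  have hconj : ∀ n (σ : IntermediateField.adjoin ℚ {β} →ₐ[ℚ] ℂ), σ ≠ realEmbedding β →
      ‖σ (scaledSum g a n)‖ ≤ B n := by
    intro n σ hσ
    rw [scaledSum, map_sum]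
    have hterm : ∀ m ∈ range (n + 1), ‖σ (g ^ (n - m) * a m)‖ ≤ C * ((n : ℝ) + 1) ^ E := by
      intro m hm
      rw [map_mul, map_pow, norm_mul, norm_pow]
      have h1 : ‖σ g‖ ^ (n - m) ≤ 1 := pow_le_one₀ (norm_nonneg _) (norm_algHom_gen_le hβ hσ)
      have h2 : (m : ℝ) ≤ n := by exact_mod_cast Nat.lt_succ_iff.mp (mem_range.mp hm)
      calc ‖σ g‖ ^ (n - m) * ‖σ (a m)‖ ≤ 1 * ‖σ (a m)‖ := by gcongr
        _ ≤ C * ((m : ℝ) + 1) ^ E := by rw [one_mul]; exact ha σ m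
        _ ≤ C * ((n : ℝ) + 1) ^ E := by gcongr
    refine (norm_sum_le_of_le _ hterm).trans ?_
    rw [sum_const, card_range, nsmul_eq_mul, hB]
    push_cast
    have : (0 : ℝ) ≤ ((n : ℝ) + 1) ^ (E + 1) := by positivity
    nlinarith [pow_succ ((n : ℝ) + 1) E]
  refine ⟨|C'| + (C + 1) ^ d, E + (E + 1) * d, by positivity, fun n => ⟨?_, fun h0 => ?_⟩⟩
  · have hn : (1 : ℝ) ≤ (n : ℝ) + 1 := by linarith [Nat.cast_nonneg (α := ℝ) n]
    calc _ ≤ C' * ((n : ℝ) + 1) ^ E := hC' n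
      _ ≤ (|C'| + (C + 1) ^ d) * ((n : ℝ) + 1) ^ (E + (E + 1) * d) := by
        gcongr
        · have : 0 ≤ (C + 1) ^ d := by positivity
          linarith [le_abs_self C']
        · exact Nat.le_add_right _ _
  · rw [hY] at h0 ⊢
    have h0' : scaledSum g a n ≠ 0 := fun h' => h0 (by rw [h']; rfl)
    refine (one_le_abs_mul_pow (hYint n) h0' (hB1 n) (hconj n)).trans ?_
    have hn : (1 : ℝ) ≤ (n : ℝ) + 1 := by linarith [Nat.cast_nonneg (α := ℝ) n]
    rw [hB, ← hd]
    refine mul_le_mul_of_nonneg_left ?_ (abs_nonneg _)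
    rw [mul_pow, ← pow_mul]
    gcongr
    · linarith [abs_nonneg C']
    · exact Nat.le_add_left _ _

end Arithmetic

end LacunaryValues

/-! ### The recursion along gaps of coefficients -/

namespace LacunaryValues

open Filter Finset

section Recursion

variable {β D : ℝ} {k : ℕ} {a Y : ℕ → ℝ}

theorem eq_pow_mul_of_gap (hrec : ∀ n, Y (n + 1) = β * Y n + a (n + 1)) {n M : ℕ}
    (h : ∀ m, n < m → m ≤ n + M → a m = 0) : Y (n + M) = β ^ M * Y n := by
  induction M with
  | zero => simp
  | succ M ih =>
    rw [← add_assoc, hrec, ih fun m h1 h2 => h m h1 (by omega), h _ (by omega) (by omega), pow_succ]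
    ring

/-- A nonzero Y n is at least 1 / (D B^k); multiplied by β^M across the gap it would exceed the
upper bound D B^k. -/
theorem eq_zero_of_gap (hβ : 1 < β) (hrec : ∀ n, Y (n + 1) = β * Y n + a (n + 1)) (hD : 0 < D)
    (hle : ∀ n, |Y n| ≤ D * ((n : ℝ) + 1) ^ k)
    (hge : ∀ n, Y n ≠ 0 → 1 ≤ |Y n| * (D * ((n : ℝ) + 1) ^ k)) {n M B : ℕ} (hB : n + M + 1 ≤ B)
    (hM : (D * (B : ℝ) ^ k) ^ 2 < β ^ M) (h : ∀ m, n < m → m ≤ n + M → a m = 0) : Y n = 0 := by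
  by_contra h0
  have h1 := hge n h0
  have h2 := hle (n + M)
  rw [eq_pow_mul_of_gap hrec h, abs_mul, abs_of_pos (by positivity : 0 < β ^ M)] at h2
  have hB' : (n : ℝ) + M + 1 ≤ B := by exact_mod_cast hB
  have hM0 : (0 : ℝ) ≤ M := Nat.cast_nonneg M
  have h3 : β ^ M * |Y n| ≤ D * (B : ℝ) ^ k := by
    refine h2.trans ?_
    push_cast
    gcongr
  have h4 : 1 ≤ |Y n| * (D * (B : ℝ) ^ k) := by
    refine h1.trans ?_
    gcongr
    linarith
  have h5 : 0 < D * (B : ℝ) ^ k := by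
    by_contra hneg
    have := mul_nonpos_of_nonneg_of_nonpos (abs_nonneg (Y n)) (not_lt.mp hneg)
    linarith
  have h6 : β ^ M ≤ β ^ M * (|Y n| * (D * (B : ℝ) ^ k)) := le_mul_of_one_le_right (by positivity) h4
  nlinarith

/-- Starting from 0, Y / c stays nonnegative. It reaches at least 1 at p, and from there each step
multiplies it at least by β. -/
theorem pow_le_abs_of_nonneg (hβ : 1 < β) (hrec : ∀ n, Y (n + 1) = β * Y n + a (n + 1)) {n b p : ℕ}
    {c : ℝ} {r : ℕ → ℕ} (ha : ∀ m, n < m → m < b → a m = c * r m)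
    (hn : Y n = 0) (hp : n < p) (hpb : p < b) (hrp : r p ≠ 0) :
    |c| * β ^ (b - 1 - p) ≤ |Y (b - 1)| := by
  have hβ0 : 0 < β := by linarith
  have key : ∀ m, n ≤ m → m < b → ∃ z : ℝ, 0 ≤ z ∧ Y m = c * z ∧ (p ≤ m → β ^ (m - p) ≤ z) := by
    intro m hm
    induction m, hm using Nat.le_induction with
    | base => exact fun _ => ⟨0, le_rfl, by simp [hn], fun h => by omega⟩
    | succ m hm ih =>
      intro hmb
      obtain ⟨z, hz0, hz, hzp⟩ := ih (by omega)
      refine ⟨β * z + r (m + 1), by positivity, ?_, fun hpm => ?_⟩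
      · rw [hrec, hz, ha _ (by omega) hmb]
        ring
      · rcases hpm.eq_or_lt with rfl | hlt
        · have : (1 : ℝ) ≤ r (m + 1) := by exact_mod_cast Nat.one_le_iff_ne_zero.mpr hrp
          simp only [Nat.sub_self, pow_zero]
          linarith [mul_nonneg hβ0.le hz0]
        · have h1 := hzp (by omega)
          have h2 : m + 1 - p = (m - p) + 1 := by omega
          rw [h2, pow_succ']
          have := mul_le_mul_of_nonneg_left h1 hβ0.le
          linarith [Nat.cast_nonneg (α := ℝ) (r (m + 1))]
  obtain ⟨z, hz0, hz, hzp⟩ := key (b - 1) (by omega) (by omega)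
  rw [hz, abs_mul, abs_of_nonneg hz0]
  exact mul_le_mul_of_nonneg_left (hzp (by omega)) (abs_nonneg c)

end Recursion

/-! ### Counting by gaps and windows -/

section Counting

variable {U W V : ℕ → Prop} [DecidablePred U] [DecidablePred W] [DecidablePred V]

theorem card_filter_range_add (P : ℕ → Prop) [DecidablePred P] {a b : ℕ} (hab : a ≤ b) :
    #{m ∈ range b | P m} = #{m ∈ range a | P m} + #{m ∈ Ico a b | P m} := by
  rw [range_eq_Ico, range_eq_Ico, ← Ico_union_Ico_eq_Ico (Nat.zero_le a) hab, filter_union,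
    card_union_of_disjoint]
  exact disjoint_filter_filter (Ico_disjoint_Ico_consecutive 0 a b)

/-- The interval up to u is cut at the elements of U, and each gap is charged to its left endpoint;
the parts of V in distinct gaps are disjoint, so their counts add up. -/
theorem le_count_of_gaps {H Δ E : ℝ} {X : ℕ} (hH : 0 ≤ H) (hΔ : 0 ≤ Δ) (h0 : U 0)
    (hgap : ∀ a b, U a → U b → a < b → a < X → (∀ m, a < m → m < b → ¬ U m) →
      (W a → (b : ℝ) - a ≤ H) ∧
        (¬ W a → (b : ℝ) - a ≤ Δ + E * #{m ∈ Ico a b | V m})) (hE : 0 ≤ E) {u : ℕ} (hu : U u)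
    (huX : u ≤ X) :
    (u : ℝ) ≤ H * #{m ∈ range u | W m} + Δ * #{m ∈ range u | U m} +
      E * #{m ∈ range u | V m} := by
  induction u using Nat.strong_induction_on with
  | _ u ih =>
  rcases Nat.eq_zero_or_pos u with rfl | hpos
  · simp
  have hne : ({m ∈ range u | U m} : Finset ℕ).Nonempty := ⟨0, by simp [hpos, h0]⟩
  set a := ({m ∈ range u | U m} : Finset ℕ).max' hne with ha
  have hmem := max'_mem _ hne
  rw [← ha, mem_filter, mem_range] at hmem
  obtain ⟨hau, hUa⟩ := hmem
  have hcons : ∀ m, a < m → m < u → ¬ U m := by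
    intro m h1 h2 h3
    have := le_max' {m ∈ range u | U m} m (by simp [h2, h3])
    omega
  have h1 := ih a hau hUa (by omega)
  obtain ⟨h2, h3⟩ := hgap a u hUa hu hau (by omega) hcons
  rw [card_filter_range_add W hau.le, card_filter_range_add U hau.le,
    card_filter_range_add V hau.le]
  push_cast
  have hUc : (1 : ℝ) ≤ #{m ∈ Ico a u | U m} := by
    exact_mod_cast card_pos.mpr ⟨a, by simp [hau, hUa]⟩
  have hE' : 0 ≤ E * (#{m ∈ Ico a u | V m} : ℝ) := by positivity
  have hW' : 0 ≤ H * (#{m ∈ Ico a u | W m} : ℝ) := by positivity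
  have hU' := mul_le_mul_of_nonneg_left hUc hΔ
  by_cases hWa : W a
  · have hWc : (1 : ℝ) ≤ #{m ∈ Ico a u | W m} := by
      exact_mod_cast card_pos.mpr ⟨a, by simp [hau, hWa]⟩
    have := mul_le_mul_of_nonneg_left hWc hH
    linarith [h2 hWa]
  · linarith [h3 hWa]

theorem le_card_of_windows {a b M q : ℕ} (hb : a + q * M < b)
    (h : ∀ i < q, ∃ v, a + i * M < v ∧ v ≤ a + (i + 1) * M ∧ V v) :
    q ≤ #{m ∈ Ico a b | V m} := by
  choose! v hv using h
  have hcard := card_le_card_of_injOn (s := range q) (t := {m ∈ Ico a b | V m}) v ?_ ?_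
  · simpa using hcard
  · intro i hi
    have hi' : i < q := by simpa using hi
    obtain ⟨h1, h2, h3⟩ := hv i hi'
    have : (i + 1) * M ≤ q * M := Nat.mul_le_mul_right M hi'
    simp only [coe_filter, mem_Ico, Set.mem_ofPred_eq]
    exact ⟨⟨by omega, by omega⟩, h3⟩
  · intro i hi j hj hij
    have hi' : i < q := by simpa using hi
    have hj' : j < q := by simpa using hj
    obtain ⟨h1, h2, -⟩ := hv i hi'
    obtain ⟨h3, h4, -⟩ := hv j hj'
    rcases lt_trichotomy i j with hlt | heq | hlt
    · have : (i + 1) * M ≤ j * M := Nat.mul_le_mul_right M hlt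
      omega
    · exact heq
    · have : (j + 1) * M ≤ i * M := Nat.mul_le_mul_right M hlt
      omega

end Counting

/-- Greedy approximation by `k`-fold sums of exponents of `F`. -/
theorem exists_coeff_pow_near {F : PowerSeries ℕ} {e C : ℝ} (he : 0 ≤ e) (hC : 0 ≤ C)
    (hF : ∀ R : ℕ, ∃ m ≤ R, PowerSeries.coeff m F ≠ 0 ∧ (R : ℝ) - m ≤ C * ((R : ℝ) + 1) ^ e)
    (k : ℕ) :
    ∃ C' : ℝ, 0 ≤ C' ∧ ∀ R : ℕ, ∃ m ≤ R, PowerSeries.coeff m (F ^ k) ≠ 0 ∧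
      (R : ℝ) - m ≤ C' * ((R : ℝ) + 1) ^ (e ^ k) := by
  induction k with
  | zero => exact ⟨1, zero_le_one, fun R => ⟨0, Nat.zero_le R, by simp, by simp⟩⟩
  | succ k ih =>
    obtain ⟨C', hC', h⟩ := ih
    refine ⟨C * (C' + 1) ^ e, by positivity, fun R => ?_⟩
    obtain ⟨m, hmR, hm, hm'⟩ := h R
    -- The remainder R - m is already O((R + 1)^(e^k)), so approximating it by one more exponent
    -- leaves the exponent e^k · e.
    obtain ⟨m', hmR', hm0, hm0'⟩ := hF (R - m)
    refine ⟨m + m', by omega, by rw [pow_succ]; exact coeff_add_mul_ne_zero hm hm0, ?_⟩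
    rw [Nat.cast_sub hmR] at hm0'
    push_cast
    have hR : (1 : ℝ) ≤ (R : ℝ) + 1 := by linarith [Nat.cast_nonneg (α := ℝ) R]
    have h1 : (1 : ℝ) ≤ ((R : ℝ) + 1) ^ (e ^ k) := Real.one_le_rpow hR (by positivity)
    have hmR1 : (m : ℝ) ≤ R := by exact_mod_cast hmR
    calc (R : ℝ) - (m + m') = R - m - m' := by ring
      _ ≤ C * ((R : ℝ) - m + 1) ^ e := hm0'
      _ ≤ C * ((C' + 1) * ((R : ℝ) + 1) ^ (e ^ k)) ^ e := by
        gcongr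
        · linarith
      _ = C * (C' + 1) ^ e * ((R : ℝ) + 1) ^ (e ^ (k + 1)) := by
        rw [Real.mul_rpow (by positivity) (by positivity), ← Real.rpow_mul (by positivity), pow_succ]
        ring

theorem GrowthLE.exists_card_le {F : PowerSeries ℕ} {e : ℝ} (hF : GrowthLE F e) (he : 0 ≤ e) :
    ∃ C : ℝ, 0 ≤ C ∧ ∀ N u : ℕ, 1 ≤ N → u ≤ 4 * N →
      (#{m ∈ range u | PowerSeries.coeff m F ≠ 0} : ℝ) ≤ C * (N : ℝ) ^ e := by
  obtain ⟨C, hC⟩ := hF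
  have hC0 : 0 ≤ C := by simpa using (Nat.cast_nonneg _).trans (hC 0)
  refine ⟨C * 5 ^ e, by positivity, fun N u hN hu => ?_⟩
  have hN' : (1 : ℝ) ≤ N := by exact_mod_cast hN
  calc (#{m ∈ range u | PowerSeries.coeff m F ≠ 0} : ℝ)
      ≤ ((∑ n ∈ range (4 * N + 1), PowerSeries.coeff n F : ℕ) : ℝ) := by
        refine Nat.cast_le.mpr ((card_filter_coeff_ne_zero_le F u).trans ?_)
        exact sum_le_sum_of_subset (range_mono (by omega))
    _ ≤ C * (((4 * N : ℕ) : ℝ) + 1) ^ e := hC (4 * N)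
    _ ≤ C * (5 * (N : ℝ)) ^ e := by
        gcongr
        push_cast
        linarith
    _ = C * 5 ^ e * (N : ℝ) ^ e := by
        rw [Real.mul_rpow (by norm_num) (by positivity)]
        ring

end LacunaryValues

/-! ### Asymptotic comparisons and the estimate of long gaps -/

namespace LacunaryValues

open Filter Finset

theorem eventually_mul_pow_lt_pow_ceil {β δ c : ℝ} (hβ : 1 < β) (hδ : 0 < δ) (hc : 0 < c) (D : ℝ)
    (k : ℕ) : ∀ᶠ N : ℕ in atTop, D * ((4 * N : ℕ) : ℝ) ^ k < c * β ^ ⌈(N : ℝ) ^ δ⌉₊ := by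
  have hlog : 0 < Real.log β := Real.log_pos hβ
  have h1 := (isLittleO_rpow_exp_pos_mul_atTop ((k : ℝ) / δ) hlog).comp_tendsto
    ((tendsto_rpow_atTop hδ).comp tendsto_natCast_atTop_atTop)
  have hK : 0 < c / (|D| * 4 ^ k + 1) := by positivity
  filter_upwards [h1.bound hK, eventually_gt_atTop 0] with N hN hN0
  have hN0' : (0 : ℝ) < N := by exact_mod_cast hN0
  simp only [Function.comp_apply] at hN
  rw [Real.norm_of_nonneg (by positivity), Real.norm_of_nonneg (by positivity),
    ← Real.rpow_mul hN0'.le, mul_div_cancel₀ _ hδ.ne', Real.rpow_natCast,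
    ← Real.rpow_def_of_pos (by linarith), div_mul_eq_mul_div, le_div_iff₀ (by positivity)] at hN
  have h2 : β ^ ((N : ℝ) ^ δ) ≤ β ^ ⌈(N : ℝ) ^ δ⌉₊ := by
    rw [← Real.rpow_natCast]
    exact Real.rpow_le_rpow_of_exponent_le hβ.le (Nat.le_ceil _)
  have h3 : D * ((4 * N : ℕ) : ℝ) ^ k ≤ (N : ℝ) ^ k * (|D| * 4 ^ k) := by
    push_cast
    rw [mul_pow]
    calc D * (4 ^ k * (N : ℝ) ^ k) ≤ |D| * (4 ^ k * (N : ℝ) ^ k) := by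
          gcongr; exact le_abs_self D
      _ = _ := by ring
  have h4 : 0 < (N : ℝ) ^ k := by positivity
  have h5 : c * β ^ ((N : ℝ) ^ δ) ≤ c * β ^ ⌈(N : ℝ) ^ δ⌉₊ := by gcongr
  linarith

theorem eventually_mul_rpow_lt {e e' : ℝ} (h : e < e') (K : ℝ) :
    ∀ᶠ N : ℕ in atTop, K * (N : ℝ) ^ e < (N : ℝ) ^ e' := by
  have h1 := (tendsto_rpow_atTop (sub_pos.mpr h)).comp tendsto_natCast_atTop_atTop
  filter_upwards [h1.eventually_gt_atTop K, eventually_gt_atTop 0] with N hN hN0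
  have hN0' : (0 : ℝ) < N := by exact_mod_cast hN0
  have : (N : ℝ) ^ e' = (N : ℝ) ^ (e' - e) * (N : ℝ) ^ e := by
    rw [← Real.rpow_add hN0']; congr 1; ring
  rw [this]
  exact mul_lt_mul_of_pos_right hN (by positivity)

/-- A long gap of the exponents `U` following an exponent of type `Q`
contains many exponents of type `V`. -/
theorem gap_le_of_scaled_bounds {β D c : ℝ} {k : ℕ} {α Y : ℕ → ℝ} {r : ℕ → ℕ} {U : ℕ → Prop}
    {G Q : PowerSeries ℕ} {P L₀ : ℕ} (hβ : 1 < β)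
    (hrec : ∀ n, Y (n + 1) = β * Y n + α (n + 1)) (hD : 0 < D)
    (hle : ∀ n, |Y n| ≤ D * ((n : ℝ) + 1) ^ k)
    (hge : ∀ n, Y n ≠ 0 → 1 ≤ |Y n| * (D * ((n : ℝ) + 1) ^ k))
    (hα : ∀ m, ¬ U m → α m = c * r m)
    (hG : ∀ L, L₀ ≤ L → ∃ t, PowerSeries.coeff t G ≠ 0 ∧ t ≤ L ∧ L ≤ P * t)
    (hr : ∀ m, r m = PowerSeries.coeff m (Q * G)) {a b M B : ℕ}
    (hQ : PowerSeries.coeff a Q ≠ 0) (hab : a < b) (hbB : b ≤ B)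
    (hM0 : 0 < M) (hM1 : (D * (B : ℝ) ^ k) ^ 2 < 1 * β ^ M) (hM2 : D * (B : ℝ) ^ k < |c| * β ^ M)
    (hU : ∀ m, a < m → m < b → ¬ U m) :
    b - a ≤ (2 * P + 2) * M + 2 * L₀ + 4 + 2 * P * M * #{m ∈ Ico a b | r m ≠ 0} := by
  by_contra! hcon
  set v := #{m ∈ Ico a b | r m ≠ 0} with hv
  have hPM : 0 ≤ P * M := Nat.zero_le _
  have hexp : (2 * P + 2) * M = 2 * (P * M) + 2 * M := by ring
  have hexp' : 2 * P * M * v = 2 * (P * M * v) := by ring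
  have hPMv : 0 ≤ P * M * v := Nat.zero_le _
  -- Halving the gap keeps at least M integers free between a + t and b, where the term at a + t can
  -- grow.
  obtain ⟨t, htG, htL, hLt⟩ := hG ((b - a) / 2) (by omega)
  have hp : r (a + t) ≠ 0 := by rw [hr]; exact coeff_add_mul_ne_zero hQ htG
  have hwin : ∀ i < t / M, ∃ w, a + i * M < w ∧ w ≤ a + (i + 1) * M ∧ r w ≠ 0 := by
    intro i hi
    by_contra! hno
    have hiM : (i + 1) * M ≤ t := (Nat.mul_le_mul_right M hi).trans (Nat.div_mul_le_self t M)
    have hsplit : (i + 1) * M = i * M + M := by ring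
    -- A window without exponents of V is a run of M zero coefficients.
    have hY0 : Y (a + i * M) = 0 := by
      refine eq_zero_of_gap (M := M) (B := B) hβ hrec hD hle hge (by omega) (by simpa using hM1) ?_
      intro m h1 h2
      rw [hα m (hU m (by omega) (by omega)), hno m h1 (by omega)]
      simp
    -- From this zero on, no cancellation is possible up to b, so the term at a + t makes Y (b - 1)
    -- too large.
    have hbig := pow_le_abs_of_nonneg (b := b) hβ hrec
      (fun m h1 h2 => hα m (hU m (by omega) h2)) hY0 (by omega) (by omega) hp
    have h1 : |c| * β ^ M ≤ |c| * β ^ (b - 1 - (a + t)) := by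
      gcongr
      · exact hβ.le
      · omega
    have h2 : |Y (b - 1)| ≤ D * (B : ℝ) ^ k := by
      refine (hle (b - 1)).trans ?_
      have : ((b - 1 : ℕ) : ℝ) + 1 ≤ B := by exact_mod_cast (by omega : b - 1 + 1 ≤ B)
      gcongr
    linarith
  have hq : t / M ≤ v := le_card_of_windows
    (by have := Nat.div_mul_le_self t M; omega) hwin
  have ht : t < (v + 1) * M := by
    have := Nat.lt_mul_div_succ t hM0
    calc t < M * (t / M + 1) := this
      _ ≤ M * (v + 1) := Nat.mul_le_mul_left M (by omega)
      _ = (v + 1) * M := Nat.mul_comm _ _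
  have hPt : P * t ≤ P * M * v + P * M := by
    calc P * t ≤ P * ((v + 1) * M) := Nat.mul_le_mul_left P ht.le
      _ = _ := by ring
  omega

end LacunaryValues

/-! ### The counting contradiction -/

namespace LacunaryValues

open Filter Finset

/-- Powers of G cost only an arbitrarily small exponent, whatever their number; this is why the
degree in the lacunary value is unrestricted. -/
theorem GrowthLE.pow_mul_pow {F G : PowerSeries ℕ} {x : ℝ} (hF : GrowthLE F x)
    (hG : ∀ ε > 0, GrowthLE G ε) (i j : ℕ) {ε : ℝ} (hε : 0 < ε) :
    GrowthLE (F ^ i * G ^ j) (i * x + ε) := by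
  have hj : (0 : ℝ) < (j : ℝ) + 1 := by positivity
  refine ((hF.pow i).mul ((hG (ε / (j + 1)) (by positivity)).pow j)).mono ?_
  have h : (j : ℝ) * (ε / (j + 1)) ≤ ε := by
    rw [mul_div_assoc', div_le_iff₀ hj]
    nlinarith
  linarith

-- The integers up to N cannot be covered by gaps of total length o(N). Here x plays the role of
-- 1/ρ, `hAx'` makes the gaps after exponents of F^(A-1) G^J negligible, and `hAx` all other gaps.
open Classical in
theorem false_of_scaled_bounds {A h J : ℕ} (hA : 1 ≤ A) (hh : 1 ≤ h) {F G : PowerSeries ℕ}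
    (hF0 : PowerSeries.coeff 0 F ≠ 0) (hG0 : PowerSeries.coeff 0 G ≠ 0)
    {x : ℝ} (hx : 0 < x) (hAx : A * x < 1) (hAx' : ((A : ℝ) - 1) * x + (1 - x) ^ A < 1)
    (hF : GrowthLE F x) (hG : ∀ ε > 0, GrowthLE G ε) {Cg : ℝ} (hCg : 0 ≤ Cg)
    (hFg : ∀ R : ℕ, ∃ m ≤ R, PowerSeries.coeff m F ≠ 0 ∧
      (R : ℝ) - m ≤ Cg * ((R : ℝ) + 1) ^ (1 - x))
    {P L₀ : ℕ}
    (hGl : ∀ L, L₀ ≤ L → ∃ t, PowerSeries.coeff t G ≠ 0 ∧ t ≤ L ∧ L ≤ P * t)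
    {β D c : ℝ} {k : ℕ} {α Y : ℕ → ℝ} (hβ : 1 < β)
    (hrec : ∀ n, Y (n + 1) = β * Y n + α (n + 1)) (hD : 0 < D)
    (hle : ∀ n, |Y n| ≤ D * ((n : ℝ) + 1) ^ k)
    (hge : ∀ n, Y n ≠ 0 → 1 ≤ |Y n| * (D * ((n : ℝ) + 1) ^ k)) (hc : c ≠ 0)
    (hα : ∀ m, PowerSeries.coeff m (F ^ (A - 1) * G ^ J) = 0 →
      PowerSeries.coeff m (F ^ A * G ^ (h - 1)) = 0 →
      α m = c * (PowerSeries.coeff m (F ^ A * G ^ h) : ℕ)) : False := by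
  have hA' : (1 : ℝ) ≤ A := by exact_mod_cast hA
  have hx1 : x < 1 := by nlinarith
  have hAsub : ((A - 1 : ℕ) : ℝ) = (A : ℝ) - 1 := by rw [Nat.cast_sub hA]; simp
  set g : ℝ := (1 - x) ^ A with hg
  have hg0 : 0 ≤ g := pow_nonneg (by linarith) A
  have hg1 : g < 1 := by
    have : 0 ≤ ((A : ℝ) - 1) * x := mul_nonneg (by linarith) hx.le
    linarith
  -- A quarter of the smaller slack absorbs every loss: the factor N^ε from powers of G and the
  -- window length N^δ.
  obtain ⟨δ, hδ, hδ1, hδ2⟩ : ∃ δ : ℝ, 0 < δ ∧ ((A : ℝ) - 1) * x + g + δ < 1 ∧ A * x + 2 * δ < 1 := by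
    refine ⟨min (1 - A * x) (1 - (((A : ℝ) - 1) * x + g)) / 4,
      div_pos (lt_min (by linarith) (by linarith)) (by norm_num), ?_, ?_⟩
    · linarith [min_le_right (1 - A * x) (1 - (((A : ℝ) - 1) * x + g))]
    · linarith [min_le_left (1 - A * x) (1 - (((A : ℝ) - 1) * x + g))]
  have hw0 : 0 ≤ ((A : ℝ) - 1) * x + δ := add_nonneg (mul_nonneg (by linarith) hx.le) hδ.le
  have hv0 : 0 ≤ (A : ℝ) * x + δ := by positivity
  obtain ⟨CW, hCW, hW⟩ := ((hF.pow_mul_pow hG (A - 1) J hδ).mono (by rw [hAsub])).exists_card_le hw0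
  obtain ⟨CU, hCU, hU⟩ := (hF.pow_mul_pow hG A (h - 1) hδ).exists_card_le hv0
  obtain ⟨CV, hCV, hV⟩ := (hF.pow_mul_pow hG A h hδ).exists_card_le hv0
  obtain ⟨C, hC, hgr⟩ := exists_coeff_pow_near (by linarith) hCg hFg A
  rw [← hg] at hgr
  set CH : ℝ := C * 5 ^ g + 2 with hCH
  have hCH0 : 0 ≤ CH := by positivity
  set K₁ : ℝ := 2 * (2 * P + 2) + 2 * L₀ + 4 with hK₁
  have hK₁0 : 0 ≤ K₁ := by positivity
  -- The last two conditions make each of the two total contributions less than N / 2.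
  obtain ⟨N, hN1, hNg, hNM1, hNM2, hNa, hNb⟩ := ((eventually_ge_atTop 1).and
    ((eventually_mul_rpow_lt hg1 CH).and
    ((eventually_mul_pow_lt_pow_ceil hβ hδ one_pos (D ^ 2) (k * 2)).and
    ((eventually_mul_pow_lt_pow_ceil hβ hδ (abs_pos.mpr hc) D k).and
    ((eventually_mul_rpow_lt hδ1 (2 * (CH * CW))).and
    (eventually_mul_rpow_lt hδ2 (2 * (K₁ * (CW + CU) + 4 * P * CV)))))))).exists
  have hN1' : (1 : ℝ) ≤ N := by exact_mod_cast hN1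
  have hN0 : (0 : ℝ) < N := by linarith
  rw [Real.rpow_one] at hNg hNa hNb
  set M := ⌈(N : ℝ) ^ δ⌉₊ with hM
  have hNδ : 1 ≤ (N : ℝ) ^ δ := Real.one_le_rpow hN1' hδ.le
  have hNgg : 1 ≤ (N : ℝ) ^ g := Real.one_le_rpow hN1' hg0
  have hM0 : 0 < M := Nat.ceil_pos.mpr (by linarith)
  have hM2 : (M : ℝ) ≤ 2 * (N : ℝ) ^ δ := by
    linarith [(Nat.ceil_lt_add_one (by positivity : 0 ≤ (N : ℝ) ^ δ)).le]
  set H := ⌈C * (((4 * N : ℕ) : ℝ) + 1) ^ g⌉₊ + 1 with hH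
  have hHle : (H : ℝ) ≤ CH * (N : ℝ) ^ g := by
    have h1 := (Nat.ceil_lt_add_one (by positivity : 0 ≤ C * (((4 * N : ℕ) : ℝ) + 1) ^ g)).le
    have h2 : C * (((4 * N : ℕ) : ℝ) + 1) ^ g ≤ C * (5 ^ g * (N : ℝ) ^ g) := by
      rw [← Real.mul_rpow (by norm_num) hN0.le]
      gcongr
      push_cast
      linarith
    rw [hH, hCH]
    push_cast at h1 h2 ⊢
    linarith
  have hHN : H ≤ N := by exact_mod_cast (hHle.trans hNg.le)
  have hnear : ∀ R ≤ 4 * N, ∃ m ≤ R, PowerSeries.coeff m (F ^ A) ≠ 0 ∧ R < m + H := by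
    intro R hR
    obtain ⟨m, hmR, hm, hm'⟩ := hgr R
    refine ⟨m, hmR, hm, ?_⟩
    have h1 : (R : ℝ) - m ≤ (⌈C * (((4 * N : ℕ) : ℝ) + 1) ^ g⌉₊ : ℝ) := by
      refine (hm'.trans ?_).trans (Nat.le_ceil _)
      have : (R : ℝ) ≤ ((4 * N : ℕ) : ℝ) := by exact_mod_cast hR
      gcongr
    have h2 : (R : ℝ) < ((m + H : ℕ) : ℝ) := by
      rw [hH]
      push_cast at h1 ⊢
      linarith
    exact_mod_cast h2
  set W : ℕ → Prop := fun m => PowerSeries.coeff m (F ^ (A - 1) * G ^ J) ≠ 0 with hWdef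
  set Q : ℕ → Prop := fun m => PowerSeries.coeff m (F ^ A * G ^ (h - 1)) ≠ 0 with hQdef
  set V : ℕ → Prop := fun m => PowerSeries.coeff m (F ^ A * G ^ h) ≠ 0 with hVdef
  have hFQ : ∀ m, PowerSeries.coeff m (F ^ A) ≠ 0 → Q m := fun m hm =>
    coeff_pow_mul_pow_ne_zero_of_le hF0 hG0 le_rfl (Nat.zero_le (h - 1)) (by simpa using hm)
  have hQ0 : Q 0 := hFQ 0 (coeff_pow_ne_zero_of_le hF0 (Nat.zero_le A) (i := 0) (by simp))
  have hgap : ∀ a b, (W a ∨ Q a) → (W b ∨ Q b) → a < b → a < 2 * N →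
      (∀ m, a < m → m < b → ¬ (W m ∨ Q m)) →
      (W a → (b : ℝ) - a ≤ H) ∧ (¬ W a → (b : ℝ) - a ≤
        (((2 * P + 2) * M + 2 * L₀ + 4 : ℕ) : ℝ) +
          ((2 * P * M : ℕ) : ℝ) * #{m ∈ Ico a b | V m}) := by
    intro a b ha _ hab haN hfree
    -- Every exponent of F^A lies in Q, and one of them lies in (a, a + H]. With a < 2N and H ≤ N
    -- this keeps b below 4N, the range of all estimates.
    have hbH : b ≤ a + H := by
      obtain ⟨m, hmR, hm, hm'⟩ := hnear (a + H) (by omega)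
      by_contra! hlt
      exact hfree m (by omega) (by omega) (Or.inr (hFQ m hm))
    refine ⟨fun _ => ?_, fun hWa => ?_⟩
    · have : (b : ℝ) ≤ ((a + H : ℕ) : ℝ) := by exact_mod_cast hbH
      push_cast at this
      linarith
    · have hQa : Q a := ha.resolve_left hWa
      have h1 := gap_le_of_scaled_bounds (U := fun m => W m ∨ Q m) (c := c) (B := 4 * N)
        (M := M) (b := b) (r := fun m => PowerSeries.coeff m (F ^ A * G ^ h)) (α := α) hβ hrec hD hle hge
        (fun m hm => by
          simp only [hWdef, hQdef, not_or, not_not] at hm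
          exact hα m hm.1 hm.2)
        hGl
        (fun m => by rw [mul_assoc, ← pow_succ, Nat.sub_add_cancel hh]) hQa hab (by omega) hM0
        (by rw [mul_pow, ← pow_mul]; exact hNM1) hNM2 hfree
      have h2 : ((b - a : ℕ) : ℝ) ≤ (((2 * P + 2) * M + 2 * L₀ + 4 +
        2 * P * M * #{m ∈ Ico a b | V m} : ℕ) : ℝ) := Nat.cast_le.mpr h1
      rw [Nat.cast_sub hab.le] at h2
      refine h2.trans_eq ?_
      rw [Nat.cast_add, Nat.cast_mul (2 * P * M)]
  -- Since H ≤ N, this endpoint satisfies N ≤ u ≤ 2N.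
  obtain ⟨u, huN, hu, huH⟩ := hnear (2 * N) (by omega)
  have hcount := le_count_of_gaps (U := fun m => W m ∨ Q m) (X := 2 * N) (Nat.cast_nonneg H)
    (Nat.cast_nonneg _) (Or.inr hQ0) hgap (Nat.cast_nonneg _) (Or.inr (hFQ u hu)) huN
  have hNu : (N : ℝ) ≤ u := by exact_mod_cast (by omega : N ≤ u)
  have hWc := hW N u hN1 (by omega)
  have hQc := hU N u hN1 (by omega)
  have hVc := hV N u hN1 (by omega)
  have hUc : (#{m ∈ range u | W m ∨ Q m} : ℝ) ≤ (CW + CU) * (N : ℝ) ^ ((A : ℝ) * x + δ) := by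
    have h1 : (#{m ∈ range u | W m ∨ Q m} : ℝ) ≤ #{m ∈ range u | W m} + #{m ∈ range u | Q m} := by
      rw [filter_or]
      exact_mod_cast card_union_le _ _
    have h2 : CW * (N : ℝ) ^ (((A : ℝ) - 1) * x + δ) ≤ CW * (N : ℝ) ^ ((A : ℝ) * x + δ) := by
      gcongr
      · linarith
    linarith
  have hΔ : (((2 * P + 2) * M + 2 * L₀ + 4 : ℕ) : ℝ) ≤ K₁ * (N : ℝ) ^ δ := by
    push_cast
    rw [hK₁]
    have h1 : (2 * (P : ℝ) + 2) * M ≤ (2 * (P : ℝ) + 2) * (2 * (N : ℝ) ^ δ) := by gcongr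
    have h2 : (2 * (L₀ : ℝ) + 4) * 1 ≤ (2 * (L₀ : ℝ) + 4) * (N : ℝ) ^ δ := by gcongr
    linarith
  have hE : ((2 * P * M : ℕ) : ℝ) ≤ 4 * P * (N : ℝ) ^ δ := by
    push_cast
    have h1 : 2 * (P : ℝ) * M ≤ 2 * (P : ℝ) * (2 * (N : ℝ) ^ δ) := by gcongr
    linarith
  have t1 : (H : ℝ) * #{m ∈ range u | W m} ≤
      CH * CW * (N : ℝ) ^ (((A : ℝ) - 1) * x + g + δ) := by
    calc _ ≤ (CH * (N : ℝ) ^ g) * (CW * (N : ℝ) ^ (((A : ℝ) - 1) * x + δ)) := by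
          gcongr
      _ = CH * CW * ((N : ℝ) ^ (((A : ℝ) - 1) * x + δ) * (N : ℝ) ^ g) := by ring
      _ = _ := by rw [← Real.rpow_add hN0]; congr 2; ring
  have hpow : (N : ℝ) ^ δ * (N : ℝ) ^ ((A : ℝ) * x + δ) = (N : ℝ) ^ ((A : ℝ) * x + 2 * δ) := by
    rw [← Real.rpow_add hN0]; congr 1; ring
  have t2 : (((2 * P + 2) * M + 2 * L₀ + 4 : ℕ) : ℝ) * #{m ∈ range u | W m ∨ Q m} ≤
      K₁ * (CW + CU) * (N : ℝ) ^ ((A : ℝ) * x + 2 * δ) := by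
    calc _ ≤ (K₁ * (N : ℝ) ^ δ) * ((CW + CU) * (N : ℝ) ^ ((A : ℝ) * x + δ)) := by gcongr
      _ = K₁ * (CW + CU) * ((N : ℝ) ^ δ * (N : ℝ) ^ ((A : ℝ) * x + δ)) := by ring
      _ = _ := by rw [hpow]
  have t3 : ((2 * P * M : ℕ) : ℝ) * #{m ∈ range u | V m} ≤
      4 * P * CV * (N : ℝ) ^ ((A : ℝ) * x + 2 * δ) := by
    calc _ ≤ (4 * P * (N : ℝ) ^ δ) * (CV * (N : ℝ) ^ ((A : ℝ) * x + δ)) := by gcongr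
      _ = 4 * P * CV * ((N : ℝ) ^ δ * (N : ℝ) ^ ((A : ℝ) * x + δ)) := by ring
      _ = _ := by rw [hpow]
  linarith

end LacunaryValues

/-! ### The conditions on ρ -/

namespace LacunaryValues

open Filter Finset

/-- The last inequality is G_A(1/ρ) < 0. For A ≤ 3 it follows from A/ρ < 1 by expansion. For A ≥ 4
it holds by convexity for 0 < 1/ρ < σ_A, and σ_A < 1/A gives the other inequality. -/
theorem exponent_conditions {A : ℕ} (hA : 1 ≤ A) {ρ : ℝ} (hsmall : A ≤ 3 → (A : ℝ) < ρ)
    (hlarge : 4 ≤ A → (sigma A)⁻¹ < ρ) :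
    1 < ρ ∧ (A : ℝ) * ρ⁻¹ < 1 ∧ ((A : ℝ) - 1) * ρ⁻¹ + (1 - ρ⁻¹) ^ A < 1 := by
  have hA' : (1 : ℝ) ≤ A := by exact_mod_cast hA
  rcases le_or_gt A 3 with h3 | h4
  · have hρ := hsmall h3
    have hρ1 : 1 < ρ := by linarith
    have hx0 : 0 < ρ⁻¹ := by positivity
    have hAx : (A : ℝ) * ρ⁻¹ < 1 := by rwa [← div_eq_mul_inv, div_lt_one (by linarith)]
    refine ⟨hρ1, hAx, ?_⟩
    generalize ρ⁻¹ = x at hx0 hAx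
    interval_cases A
    · norm_num
      linarith
    · norm_num at hAx ⊢
      nlinarith
    · norm_num at hAx ⊢
      nlinarith [mul_pos hx0 (by linarith : 0 < 1 - 3 * x), pow_pos hx0 3]
  · have hA4 : (4 : ℝ) ≤ A := by exact_mod_cast h4
    obtain ⟨⟨hs0, hs1⟩, hs⟩ := sigma_spec A (by omega)
    have hlt := hlarge h4
    have hρ1 : 1 < ρ := (one_lt_inv₀ hs0 |>.mpr hs1).trans hlt
    have hx0 : 0 < ρ⁻¹ := by positivity
    have hxs : ρ⁻¹ < sigma A := by
      rw [inv_lt_comm₀ (by linarith) hs0]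
      exact hlt
    have hconv : ConvexOn ℝ (Set.Iic (1 : ℝ)) (G A) := by
      refine ⟨convex_Iic 1, ?_⟩
      intro a ha b hb p q hp hq hpq
      have h := (convexOn_pow A).2 (x := 1 - a) (y := 1 - b) (by simpa using ha) (by simpa using hb)
        hp hq hpq
      simp only [smul_eq_mul] at h ⊢
      rw [show p * (1 - a) + q * (1 - b) = 1 - (p * a + q * b) by linear_combination hpq] at h
      unfold G
      obtain rfl : q = 1 - p := by linarith
      linarith
    have hneg : ∀ a, 0 < a → a ≤ sigma A → G A a ≤ 0 := by
      intro a ha has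
      have h := hconv.2 (show (0 : ℝ) ∈ Set.Iic 1 by simp) (show sigma A ∈ Set.Iic 1 from hs1.le)
        (show 0 ≤ 1 - a / sigma A by rw [sub_nonneg, div_le_one hs0]; exact has)
        (show 0 ≤ a / sigma A by positivity) (by ring)
      simp only [smul_eq_mul, mul_zero, zero_add, hs] at h
      rw [div_mul_cancel₀ _ hs0.ne'] at h
      simpa [G] using h
    -- G_A(1/A) = (1 - 1/A)^A - 1/A is positive: Bernoulli with exponent A/2 gives (1 - 1/A)^A > 1/4
    -- ≥ 1/A.
    have hsA : sigma A < (A : ℝ)⁻¹ := by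
      by_contra! hcon
      have h1 := hneg _ (by positivity) hcon
      have h2 : (1 / 4 : ℝ) < (1 - (A : ℝ)⁻¹) ^ A := by
        have hb := one_add_mul_self_lt_rpow_one_add (s := -(A : ℝ)⁻¹)
          (neg_le_neg (inv_le_one_of_one_le₀ hA')) (neg_ne_zero.mpr (by positivity))
          (p := (A : ℝ) / 2) (by linarith)
        have e1 : 1 + (A : ℝ) / 2 * -(A : ℝ)⁻¹ = 1 / 2 := by
          field_simp
          norm_num
        have hnn : 0 ≤ 1 + -(A : ℝ)⁻¹ := by linarith [inv_le_one_of_one_le₀ hA']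
        have e2 : ((1 + -(A : ℝ)⁻¹) ^ ((A : ℝ) / 2)) ^ 2 = (1 - (A : ℝ)⁻¹) ^ A := by
          rw [← Real.rpow_natCast, ← Real.rpow_mul hnn, Nat.cast_ofNat,
            div_mul_cancel₀ _ two_ne_zero, Real.rpow_natCast, ← sub_eq_add_neg]
        rw [e1] at hb
        rw [← e2]
        nlinarith
      have h3 : (A : ℝ)⁻¹ ≤ 1 / 4 := by rw [inv_le_comm₀ (by linarith) (by norm_num)]; linarith
      unfold G at h1
      have h5 : ((A : ℝ) - 1) * (A : ℝ)⁻¹ = 1 - (A : ℝ)⁻¹ := by field_simp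
      linarith
    refine ⟨hρ1, ?_, ?_⟩
    · have := hxs.trans hsA
      rwa [← div_eq_mul_inv, div_lt_one (by linarith), ← inv_lt_inv₀ (by positivity) (by linarith)]
    · have hlt : G A ρ⁻¹ < 0 := by
        refine lt_of_le_of_ne (hneg _ hx0 hxs.le) fun h0 => ?_
        exact hxs.ne (eq_sigma A (by omega) _ ⟨hx0, hxs.trans hs1⟩ h0)
      unfold G at hlt
      linarith

/-! ### The exponents ⌊m^ρ⌋ -/

section Power

variable {ρ : ℝ}

theorem le_floor_rpow (hρ : 1 ≤ ρ) (m : ℕ) : m ≤ ⌊(m : ℝ) ^ ρ⌋₊ := by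
  rcases Nat.eq_zero_or_pos m with rfl | hm
  · exact Nat.zero_le _
  · exact Nat.le_floor (Real.self_le_rpow_of_one_le (by exact_mod_cast hm) hρ)

theorem tendsto_floor_rpow (hρ : 1 ≤ ρ) : Tendsto (fun m : ℕ => ⌊(m : ℝ) ^ ρ⌋₊) atTop atTop :=
  tendsto_atTop_mono (le_floor_rpow hρ) tendsto_id

theorem growthLE_floor_rpow (hρ : 1 < ρ) :
    GrowthLE (countSeries fun m : ℕ => ⌊(m : ℝ) ^ ρ⌋₊) ρ⁻¹ := by
  refine ⟨2, fun N => ?_⟩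
  have hN : (1 : ℝ) ≤ (N : ℝ) + 1 := by linarith [Nat.cast_nonneg (α := ℝ) N]
  have h := sum_coeff_countSeries_le (s := fun m : ℕ => ⌊(m : ℝ) ^ ρ⌋₊) (N := N + 1)
    (B := ⌈((N : ℝ) + 1) ^ ρ⁻¹⌉₊) fun m hm => by
      have h1 := (Nat.floor_lt (by positivity)).mp hm
      push_cast at h1
      rw [Nat.lt_ceil]
      exact (Real.lt_rpow_inv_iff_of_pos (by positivity) (by positivity) (by linarith)).mpr h1
  have h2 := (Nat.ceil_lt_add_one (by positivity : 0 ≤ ((N : ℝ) + 1) ^ ρ⁻¹)).le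
  have h3 : 1 ≤ ((N : ℝ) + 1) ^ ρ⁻¹ := Real.one_le_rpow hN (by positivity)
  have h4 : ((∑ n ∈ range (N + 1), PowerSeries.coeff n (countSeries fun m : ℕ => ⌊(m : ℝ) ^ ρ⌋₊) :
      ℕ) : ℝ) ≤ (⌈((N : ℝ) + 1) ^ ρ⁻¹⌉₊ : ℝ) := by exact_mod_cast h
  linarith

/-- Bernoulli's inequality at -1/(a+1), multiplied by (a+1)^ρ. -/
theorem rpow_add_one_sub_le (hρ : 1 ≤ ρ) {a : ℝ} (ha : 0 ≤ a) :
    (a + 1) ^ ρ - a ^ ρ ≤ ρ * (a + 1) ^ (ρ - 1) := by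
  have ha1 : 0 < a + 1 := by linarith
  have h := one_add_mul_self_le_rpow_one_add (s := -(1 / (a + 1)))
    (by rw [neg_le_neg_iff, div_le_one ha1]; linarith) hρ
  rw [show 1 + -(1 / (a + 1)) = a / (a + 1) by field_simp; ring,
    Real.div_rpow ha ha1.le, le_div_iff₀ (by positivity)] at h
  rw [Real.rpow_sub_one ha1.ne']
  have : (1 + ρ * -(1 / (a + 1))) * (a + 1) ^ ρ = (a + 1) ^ ρ - ρ * ((a + 1) ^ ρ / (a + 1)) := by
    ring
  linarith

/-- With k = ⌊R^(1/ρ)⌋, the distance from R to k^ρ is at most (k+1)^ρ - k^ρ = O(k^(ρ-1)), and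
k^(ρ-1) is of order R^(1-1/ρ). -/
theorem exists_floor_rpow_near (hρ : 1 < ρ) (R : ℕ) :
    ∃ m ≤ R, PowerSeries.coeff m (countSeries fun m : ℕ => ⌊(m : ℝ) ^ ρ⌋₊) ≠ 0 ∧
      (R : ℝ) - m ≤ (ρ * 2 ^ (ρ - 1) + 1) * ((R : ℝ) + 1) ^ (1 - ρ⁻¹) := by
  have hR0 : (0 : ℝ) ≤ R := Nat.cast_nonneg R
  have hρ0 : 0 < ρ := by linarith
  set k := ⌊(R : ℝ) ^ ρ⁻¹⌋₊ with hk
  have hk1 : (k : ℝ) ≤ (R : ℝ) ^ ρ⁻¹ := Nat.floor_le (by positivity)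
  have hk2 : (R : ℝ) ^ ρ⁻¹ < (k : ℝ) + 1 := Nat.lt_floor_add_one _
  have hkR : (k : ℝ) ^ ρ ≤ R := (Real.le_rpow_inv_iff_of_pos (by positivity) hR0 hρ0).mp hk1
  have hkR' : (R : ℝ) < ((k : ℝ) + 1) ^ ρ :=
    (Real.rpow_inv_lt_iff_of_pos hR0 (by positivity) hρ0).mp hk2
  refine ⟨⌊(k : ℝ) ^ ρ⌋₊, Nat.floor_le_of_le hkR,
    coeff_countSeries_ne_zero (tendsto_floor_rpow hρ.le) k, ?_⟩
  have h1 := Nat.lt_floor_add_one ((k : ℝ) ^ ρ)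
  have h2 := rpow_add_one_sub_le hρ.le (Nat.cast_nonneg (α := ℝ) k)
  have hR1 : (1 : ℝ) ≤ (R : ℝ) + 1 := by linarith
  have h3 : (k : ℝ) + 1 ≤ 2 * ((R : ℝ) + 1) ^ ρ⁻¹ := by
    have h4 : (R : ℝ) ^ ρ⁻¹ ≤ ((R : ℝ) + 1) ^ ρ⁻¹ := by gcongr; linarith
    have h5 : 1 ≤ ((R : ℝ) + 1) ^ ρ⁻¹ := Real.one_le_rpow hR1 (by positivity)
    linarith
  have h4 : ((k : ℝ) + 1) ^ (ρ - 1) ≤ 2 ^ (ρ - 1) * ((R : ℝ) + 1) ^ (1 - ρ⁻¹) := by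
    calc ((k : ℝ) + 1) ^ (ρ - 1) ≤ (2 * ((R : ℝ) + 1) ^ ρ⁻¹) ^ (ρ - 1) := by
          have : 0 ≤ ρ - 1 := by linarith
          gcongr
      _ = _ := by
          rw [Real.mul_rpow (by norm_num) (by positivity), ← Real.rpow_mul (by positivity)]
          congr 2
          field_simp
  have h5 : 1 ≤ ((R : ℝ) + 1) ^ (1 - ρ⁻¹) :=
    Real.one_le_rpow hR1 (by rw [sub_nonneg]; exact inv_le_one_of_one_le₀ hρ.le)
  have h6 := mul_le_mul_of_nonneg_left h4 hρ0.le
  linarith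

end Power

theorem summable_pow_of_eventually_le {s : ℕ → ℕ} (hs : ∀ᶠ m in atTop, m ≤ s m) {x : ℝ}
    (hx0 : 0 ≤ x) (hx1 : x < 1) : Summable fun m => x ^ s m := by
  refine Summable.of_norm_bounded_eventually_nat (summable_geometric_of_lt_one hx0 hx1) ?_
  filter_upwards [hs] with m hm
  rw [Real.norm_of_nonneg (by positivity)]
  exact pow_le_pow_of_le_one hx0 hx1.le hm

/-! ### Lacunary sequences -/

/-- Sequences that grow faster than every power, but at most geometrically. -/
structure IsLacunary (t : ℕ → ℕ) : Prop where
  pow_le : ∀ k : ℕ, ∀ᶠ m in atTop, m ^ k ≤ t m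
  succ_le : ∃ P : ℕ, ∀ᶠ m in atTop, t (m + 1) ≤ P * t m

namespace IsLacunary

variable {t : ℕ → ℕ}

theorem eventually_le (ht : IsLacunary t) : ∀ᶠ m in atTop, m ≤ t m := by
  simpa using ht.pow_le 1

theorem tendsto (ht : IsLacunary t) : Tendsto t atTop atTop :=
  tendsto_atTop_mono' _ ht.eventually_le tendsto_id

theorem growthLE (ht : IsLacunary t) {ε : ℝ} (hε : 0 < ε) : GrowthLE (countSeries t) ε := by
  obtain ⟨k, hk⟩ := exists_nat_gt ε⁻¹
  have hk0 : (0 : ℝ) < k := (inv_pos.mpr hε).trans hk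
  obtain ⟨m₀, hm₀⟩ := (ht.pow_le k).exists_forall_of_atTop
  refine ⟨m₀ + 2, fun N => ?_⟩
  have hN : (1 : ℝ) ≤ (N : ℝ) + 1 := by linarith [Nat.cast_nonneg (α := ℝ) N]
  have h := sum_coeff_countSeries_le (s := t) (N := N + 1)
    (B := m₀ + ⌈((N : ℝ) + 1) ^ ε⌉₊) fun m hm => by
      rcases lt_or_ge m m₀ with h | h
      · omega
      · have h1 : ((m ^ k : ℕ) : ℝ) < ((N + 1 : ℕ) : ℝ) := by
          exact_mod_cast (hm₀ m h).trans_lt hm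
        push_cast at h1
        rw [← Real.rpow_natCast, ← Real.lt_rpow_inv_iff_of_pos (by positivity) (by positivity) hk0]
          at h1
        have h2 : ((N : ℝ) + 1) ^ (k : ℝ)⁻¹ ≤ ((N : ℝ) + 1) ^ ε :=
          Real.rpow_le_rpow_of_exponent_le hN (inv_le_of_inv_le₀ hε hk.le)
        have := Nat.lt_ceil.mpr (h1.trans_le h2)
        omega
  have h2 := (Nat.ceil_lt_add_one (by positivity : 0 ≤ ((N : ℝ) + 1) ^ ε)).le
  have h3 : 1 ≤ ((N : ℝ) + 1) ^ ε := Real.one_le_rpow hN hε.le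
  have h4 : ((∑ n ∈ range (N + 1), PowerSeries.coeff n (countSeries t) : ℕ) : ℝ) ≤
      m₀ + (⌈((N : ℝ) + 1) ^ ε⌉₊ : ℝ) := by exact_mod_cast h
  have h5 : (m₀ : ℝ) * 1 ≤ m₀ * ((N : ℝ) + 1) ^ ε := by gcongr
  linarith

/-- For the last index m with t m ≤ L, the next term is at least L but at most P · t m. -/
theorem exists_near (ht : IsLacunary t) : ∃ P L₀ : ℕ, ∀ L, L₀ ≤ L →
    ∃ u, PowerSeries.coeff u (countSeries t) ≠ 0 ∧ u ≤ L ∧ L ≤ P * u := by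
  obtain ⟨P, hP⟩ := ht.succ_le
  obtain ⟨m₀, hm₀⟩ := hP.exists_forall_of_atTop
  refine ⟨P, t m₀, fun L hL => ?_⟩
  obtain ⟨m₁, hm₁⟩ := (ht.tendsto.eventually_gt_atTop L).exists_forall_of_atTop
  classical
  have hbound : ∀ m, m₀ ≤ m ∧ t m ≤ L → m ≤ m₁ := fun m hm => by
    by_contra! h
    exact absurd (hm₁ m h.le) (by omega)
  have hm := Nat.findGreatest_spec (P := fun m => m₀ ≤ m ∧ t m ≤ L) (hbound m₀ ⟨le_rfl, hL⟩)
    ⟨le_rfl, hL⟩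
  set m := Nat.findGreatest (fun m => m₀ ≤ m ∧ t m ≤ L) m₁ with hmdef
  refine ⟨t m, coeff_countSeries_ne_zero ht.tendsto m, hm.2, ?_⟩
  refine le_trans ?_ (hm₀ m hm.1)
  by_contra! hlt
  have h1 : m₀ ≤ m + 1 ∧ t (m + 1) ≤ L := ⟨by omega, hlt.le⟩
  have h2 := Nat.le_findGreatest (P := fun m => m₀ ≤ m ∧ t m ≤ L) (hbound _ h1) h1
  omega

theorem of_floor {v : ℕ → ℝ} (h1 : ∀ k : ℕ, ∀ᶠ m : ℕ in atTop, (m : ℝ) ^ k ≤ v m)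
    (h2 : ∃ P : ℝ, ∀ᶠ m : ℕ in atTop, v (m + 1) ≤ P * v m) :
    IsLacunary fun m => ⌊v m⌋₊ := by
  constructor
  · intro k
    filter_upwards [h1 k] with m hm
    refine Nat.le_floor ?_
    push_cast
    exact hm
  · obtain ⟨P, hP⟩ := h2
    obtain ⟨Q, hQ⟩ := exists_nat_ge P
    -- The factor 2 pays for the floor: v ≤ ⌊v⌋ + 1 ≤ 2⌊v⌋ once v ≥ 1.
    refine ⟨2 * Q, ?_⟩
    filter_upwards [hP, h1 0] with m hm hm1
    rw [pow_zero] at hm1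
    have h3 : 1 ≤ ⌊v m⌋₊ := Nat.le_floor (by simpa using hm1)
    have h3' : (1 : ℝ) ≤ (⌊v m⌋₊ : ℝ) := by exact_mod_cast h3
    have h4 := (Nat.lt_floor_add_one (v m)).le
    refine Nat.floor_le_of_le (hm.trans ?_)
    push_cast
    calc P * v m ≤ Q * v m := by gcongr
      _ ≤ Q * (2 * (⌊v m⌋₊ : ℝ)) := by gcongr; linarith
      _ = _ := by ring

/-- The sequence `0, u 0, u 1, …`. -/
def consZero (u : ℕ → ℕ) : ℕ → ℕ
  | 0 => 0
  | m + 1 => u m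

theorem consZero_isLacunary {u : ℕ → ℕ} (hu : IsLacunary u) : IsLacunary (consZero u) := by
  constructor
  · intro k
    rw [← map_add_atTop_eq_nat 1, eventually_map]
    filter_upwards [hu.pow_le (k + 1), eventually_ge_atTop (2 ^ k), eventually_ge_atTop 1]
      with m hm h2 h1
    calc (m + 1) ^ k ≤ (2 * m) ^ k := Nat.pow_le_pow_left (by omega) k
      _ = 2 ^ k * m ^ k := mul_pow _ _ _
      _ ≤ m * m ^ k := Nat.mul_le_mul_right _ h2
      _ = m ^ (k + 1) := (pow_succ' m k).symm
      _ ≤ u m := hm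
  · obtain ⟨P, hP⟩ := hu.succ_le
    refine ⟨P, ?_⟩
    rw [← map_add_atTop_eq_nat 1, eventually_map]
    exact hP

theorem tsum_consZero {u : ℕ → ℕ} (hu : IsLacunary u) {x : ℝ} (hx0 : 0 ≤ x) (hx1 : x < 1) :
    ∑' m, x ^ consZero u m = 1 + ∑' m, x ^ u m := by
  rw [(summable_pow_of_eventually_le (consZero_isLacunary hu).eventually_le hx0 hx1).tsum_eq_zero_add]
  simp [consZero]

end IsLacunary

theorem isLacunary_floor_pow {y : ℝ} (hy : 1 < y) : IsLacunary fun m => ⌊y ^ m⌋₊ := by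
  refine IsLacunary.of_floor (fun k => ?_) ⟨y, Eventually.of_forall fun m => (pow_succ' y m).le⟩
  have h := tendsto_pow_const_div_const_pow_of_one_lt k hy
  filter_upwards [h.eventually_le_const zero_lt_one] with m hm
  rwa [div_le_one (by positivity)] at hm

/-! ### Growth of φ -/

section Phi

open Asymptotics

variable {y z : ℝ}

/-- With u = log R, log φ is u times u^y (log u)^z, and the second factor tends to infinity exactly
because (y, z) ∈ Θ. -/
theorem eventually_pow_le_phi (h : (y, z) ∈ Theta) (k : ℕ) :
    ∀ᶠ R : ℝ in atTop, R ^ k ≤ phi y z R := by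
  have hu : ∀ᶠ u : ℝ in atTop, (k : ℝ) ≤ u ^ y * Real.log u ^ z := by
    rcases h with hy | ⟨hy, hz⟩
    · have h1 := (isLittleO_log_rpow_rpow_atTop (-z) hy).bound
        (show (0 : ℝ) < 1 / (k + 1) by positivity)
      filter_upwards [h1, eventually_gt_atTop 1] with u hu hu1
      have hlog : 0 < Real.log u := Real.log_pos hu1
      rw [Real.norm_of_nonneg (by positivity), Real.norm_of_nonneg (by positivity),
        Real.rpow_neg hlog.le, div_mul_eq_mul_div, one_mul, le_div_iff₀ (by positivity),
        inv_mul_le_iff₀ (by positivity)] at hu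
      linarith
    · simp only at hy hz
      subst hy
      simp only [Real.rpow_zero, one_mul]
      exact ((tendsto_rpow_atTop hz).comp Real.tendsto_log_atTop).eventually_ge_atTop _
  filter_upwards [Real.tendsto_log_atTop.eventually hu, eventually_gt_atTop 1] with R hR hR1
  have hlog : 0 < Real.log R := Real.log_pos hR1
  have hR0 : 0 < R := by linarith
  rw [phi, ← Real.exp_log (pow_pos hR0 k), Real.log_pow, Real.exp_le_exp, Real.rpow_add hlog,
    Real.rpow_one]
  have := mul_le_mul_of_nonneg_left hR hlog.le
  linarith

theorem one_add_pow_le {x : ℝ} (hx0 : 0 ≤ x) (hx1 : x ≤ 1) (n : ℕ) :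
    (1 + x) ^ n ≤ 1 + 3 ^ n * x := by
  induction n with
  | zero => simp [hx0]
  | succ n ih =>
    have h1 : (1 : ℝ) ≤ 3 ^ n := one_le_pow₀ (by norm_num)
    have h2 : (3 : ℝ) ^ n * x * x ≤ 3 ^ n * x * 1 := by gcongr
    have h3 : 1 * x ≤ (3 : ℝ) ^ n * x := by gcongr
    rw [pow_succ, pow_succ]
    nlinarith

/-- Since log u / u decreases for u ≥ e, the ratio of the logarithms is at most u'/u; this bounds
both factors by the same power. -/
theorem rpow_mul_log_rpow_le {u u' : ℝ} {q : ℕ} (hu : Real.exp 1 ≤ u) (huu : u ≤ u')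
    (hy : 1 + y ≤ q) (hz : |z| ≤ q) :
    u' ^ (1 + y) * Real.log u' ^ z ≤ (u' / u) ^ (2 * q) * (u ^ (1 + y) * Real.log u ^ z) := by
  have hu0 : 0 < u := (Real.exp_pos 1).trans_le hu
  have hl : 1 ≤ Real.log u := by rwa [Real.le_log_iff_exp_le hu0]
  have hl' : Real.log u ≤ Real.log u' := Real.log_le_log hu0 huu
  have hl0 : 0 < Real.log u := by linarith
  have hθ : 1 ≤ u' / u := by rwa [one_le_div hu0]
  have hθ0 : 0 ≤ u' / u := by linarith
  have hlam : 1 ≤ Real.log u' / Real.log u := by rwa [one_le_div hl0]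
  have hlamθ : Real.log u' / Real.log u ≤ u' / u := by
    have := Real.log_div_self_antitoneOn (Set.mem_Ici.mpr hu) (Set.mem_Ici.mpr (hu.trans huu)) huu
    simp only at this
    rw [div_le_div_iff₀ (by linarith) hu0] at this
    rw [div_le_div_iff₀ hl0 hu0]
    linarith
  have h1 : (u' / u) ^ (1 + y) ≤ (u' / u) ^ q := by
    rw [← Real.rpow_natCast]
    exact Real.rpow_le_rpow_of_exponent_le hθ hy
  have h2 : (Real.log u' / Real.log u) ^ z ≤ (u' / u) ^ q := by
    calc (Real.log u' / Real.log u) ^ z ≤ (Real.log u' / Real.log u) ^ (q : ℝ) :=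
          Real.rpow_le_rpow_of_exponent_le hlam ((le_abs_self z).trans hz)
      _ = (Real.log u' / Real.log u) ^ q := Real.rpow_natCast _ _
      _ ≤ (u' / u) ^ q := by gcongr
  have e1 : u' ^ (1 + y) = (u' / u) ^ (1 + y) * u ^ (1 + y) := by
    rw [← Real.mul_rpow hθ0 hu0.le, div_mul_cancel₀ _ hu0.ne']
  have e2 : Real.log u' ^ z = (Real.log u' / Real.log u) ^ z * Real.log u ^ z := by
    rw [← Real.mul_rpow (by linarith) hl0.le, div_mul_cancel₀ _ hl0.ne']
  rw [e1, e2, two_mul, pow_add]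
  calc _ = ((u' / u) ^ (1 + y) * (Real.log u' / Real.log u) ^ z) *
        (u ^ (1 + y) * Real.log u ^ z) := by ring
    _ ≤ _ := by gcongr

/-- From R to R + 1, ψ = log φ grows by a factor 1 + O(1/R). As ψ ≤ (log R)^(2q) ≤ R, its increment
is bounded. -/
theorem exists_eventually_phi_add_one_le (y z : ℝ) :
    ∃ P : ℝ, ∀ᶠ R : ℝ in atTop, phi y z (R + 1) ≤ P * phi y z R := by
  obtain ⟨q, hq⟩ := exists_nat_ge (max (1 + y) |z|)
  have hy : 1 + y ≤ q := (le_max_left _ _).trans hq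
  have hz : |z| ≤ q := (le_max_right _ _).trans hq
  refine ⟨Real.exp (3 ^ (2 * q)), ?_⟩
  have hlogpow := (Real.isLittleO_pow_log_id_atTop (n := 2 * q)).bound one_pos
  filter_upwards [hlogpow, eventually_ge_atTop 1,
    Real.tendsto_log_atTop.eventually_ge_atTop (Real.exp 1)] with R hR hR1 hRe
  have hR0 : 0 < R := by linarith
  have hu0 : 0 < Real.log R := (Real.exp_pos 1).trans_le hRe
  have hu1 : 1 ≤ Real.log R := by linarith [Real.add_one_le_exp (1 : ℝ)]
  rw [Real.norm_of_nonneg (by positivity), one_mul, id, Real.norm_of_nonneg hR0.le] at hR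
  have hmono : Real.log R ≤ Real.log (R + 1) := Real.log_le_log hR0 (by linarith)
  have hθ : Real.log (R + 1) / Real.log R ≤ 1 + 1 / R := by
    have h1 : Real.log (R + 1) ≤ Real.log R + 1 / R := by
      have h2 := Real.log_le_sub_one_of_pos (x := (R + 1) / R) (by positivity)
      rw [Real.log_div (by linarith) hR0.ne', add_div, div_self hR0.ne'] at h2
      linarith
    rw [div_le_iff₀ hu0]
    have h3 : 1 / R * 1 ≤ 1 / R * Real.log R := by gcongr
    linarith
  set ψ := Real.log R ^ (1 + y) * Real.log (Real.log R) ^ z with hψ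
  have hl : 1 ≤ Real.log (Real.log R) := by rwa [Real.le_log_iff_exp_le hu0]
  have hψ0 : 0 ≤ ψ := by positivity
  have hψR : ψ ≤ R := by
    refine le_trans ?_ hR
    rw [two_mul, pow_add, hψ]
    have h1 : Real.log R ^ (1 + y) ≤ Real.log R ^ q := by
      rw [← Real.rpow_natCast]
      exact Real.rpow_le_rpow_of_exponent_le hu1 hy
    have h2 : Real.log (Real.log R) ^ z ≤ Real.log R ^ q := by
      calc Real.log (Real.log R) ^ z ≤ Real.log (Real.log R) ^ (q : ℝ) :=
            Real.rpow_le_rpow_of_exponent_le hl ((le_abs_self z).trans hz)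
        _ = Real.log (Real.log R) ^ q := Real.rpow_natCast _ _
        _ ≤ Real.log R ^ q := by
          gcongr
          linarith [Real.log_le_sub_one_of_pos hR0]
    gcongr
  rw [phi, phi, ← Real.exp_add, Real.exp_le_exp, ← hψ]
  have h1 := rpow_mul_log_rpow_le (y := y) (z := z) hRe hmono hy hz
  rw [← hψ] at h1
  have hθ0 : 0 ≤ Real.log (R + 1) / Real.log R := div_nonneg (by linarith) hu0.le
  have h2 : (Real.log (R + 1) / Real.log R) ^ (2 * q) ≤ 1 + 3 ^ (2 * q) * (1 / R) :=
    (pow_le_pow_left₀ hθ0 hθ _).trans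
      (one_add_pow_le (by positivity) (by rw [div_le_one hR0]; exact hR1) _)
  have h3 : (3 : ℝ) ^ (2 * q) * (1 / R) * ψ ≤ 3 ^ (2 * q) := by
    rw [mul_assoc]
    refine mul_le_of_le_one_right (by positivity) ?_
    rw [one_div, inv_mul_le_iff₀ hR0, mul_one]
    exact hψR
  have h4 := mul_le_mul_of_nonneg_right h2 hψ0
  linarith

theorem isLacunary_floor_phi (h : (y, z) ∈ Theta) :
    IsLacunary fun m : ℕ => ⌊phi y z ((m + 3 : ℕ) : ℝ)⌋₊ := by
  have ht : Tendsto (fun m : ℕ => ((m + 3 : ℕ) : ℝ)) atTop atTop :=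
    tendsto_natCast_atTop_atTop.comp (tendsto_add_atTop_nat 3)
  refine IsLacunary.of_floor (fun k => ?_) ?_
  · filter_upwards [ht.eventually (eventually_pow_le_phi h k)] with m hm
    refine le_trans ?_ hm
    gcongr
    omega
  · obtain ⟨P, hP⟩ := exists_eventually_phi_add_one_le y z
    refine ⟨P, ?_⟩
    filter_upwards [ht.eventually hP] with m hm
    convert hm using 2
    push_cast
    ring

end Phi

end LacunaryValues

/-! ### From a polynomial relation to the contradiction -/

namespace LacunaryValues

open Filter Finset

section Relation

variable {β : ℝ}

/-- A polynomial expression in two power series, as a power series with coefficients in `ℚ(β)`. -/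
noncomputable def combCoeff {K : Type*} [Semiring K] (c : ℕ → ℕ → K) (A J : ℕ)
    (F G : PowerSeries ℕ) (m : ℕ) : K :=
  ∑ i ∈ range (A + 1), ∑ j ∈ range (J + 1), c i j * (PowerSeries.coeff m (F ^ i * G ^ j) : ℕ)

theorem hasSum_combCoeff (c : ℕ → ℕ → ℝ) (A J : ℕ) {F G : PowerSeries ℕ} {x v w : ℝ}
    (hF : HasValue F x v) (hG : HasValue G x w) :
    HasSum (fun m => combCoeff c A J F G m * x ^ m)
      (∑ i ∈ range (A + 1), ∑ j ∈ range (J + 1), c i j * (v ^ i * w ^ j)) := by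
  simp only [combCoeff, sum_mul]
  refine hasSum_sum fun i _ => hasSum_sum fun j _ => ?_
  have h := ((hF.pow i).mul (hG.pow j)).mul_left (c i j)
  simpa only [mul_assoc] using h

/-- Monotonicity of supports: terms with i < A are supported in F^(A-1) G^J, those with i = A and j
< h in F^A G^(h-1). -/
theorem combCoeff_eq_single {K : Type*} [Semiring K] {c : ℕ → ℕ → K} {A J h : ℕ} (hhJ : h ≤ J)
    {F G : PowerSeries ℕ} (hF : PowerSeries.coeff 0 F ≠ 0) (hG : PowerSeries.coeff 0 G ≠ 0)
    (hc : ∀ j, h < j → c A j = 0) {m : ℕ}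
    (h1 : PowerSeries.coeff m (F ^ (A - 1) * G ^ J) = 0)
    (h2 : PowerSeries.coeff m (F ^ A * G ^ (h - 1)) = 0) :
    combCoeff c A J F G m = c A h * (PowerSeries.coeff m (F ^ A * G ^ h) : ℕ) := by
  rw [combCoeff, sum_eq_single_of_mem A (self_mem_range_succ A),
    sum_eq_single_of_mem h (mem_range.mpr (by omega))]
  · intro j _ hj
    rcases lt_or_gt_of_ne hj with hlt | hgt
    · have h0 : PowerSeries.coeff m (F ^ A * G ^ j) = 0 := by
        by_contra h0
        exact coeff_pow_mul_pow_ne_zero_of_le hF hG le_rfl (by omega) h0 h2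
      simp [h0]
    · simp [hc j hgt]
  · intro i hi hiA
    refine sum_eq_zero fun j hj => ?_
    rw [mem_range] at hi hj
    have h0 : PowerSeries.coeff m (F ^ i * G ^ j) = 0 := by
      by_contra h0
      exact coeff_pow_mul_pow_ne_zero_of_le hF hG (by omega) (by omega) h0 h1
    simp [h0]

theorem exists_norm_combCoeff_le (c : ℕ → ℕ → IntermediateField.adjoin ℚ {β}) (A J : ℕ)
    [FiniteDimensional ℚ (IntermediateField.adjoin ℚ {β})]
    {F G : PowerSeries ℕ} (hF : GrowthLE F 1) (hG : GrowthLE G 1) :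
    ∃ C : ℝ, ∀ (σ : IntermediateField.adjoin ℚ {β} →ₐ[ℚ] ℂ) (m : ℕ),
      ‖σ (combCoeff c A J F G m)‖ ≤ C * ((m : ℝ) + 1) ^ (A + J) := by
  have h : ∀ i j, ∃ C : ℝ, 0 ≤ C ∧ (i ≤ A → j ≤ J → ∀ m : ℕ,
      ((PowerSeries.coeff m (F ^ i * G ^ j) : ℕ) : ℝ) ≤ C * ((m : ℝ) + 1) ^ (A + J)) := by
    intro i j
    by_cases hij : i ≤ A ∧ j ≤ J
    · have hi : (i : ℝ) ≤ A := by exact_mod_cast hij.1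
      have hj : (j : ℝ) ≤ J := by exact_mod_cast hij.2
      obtain ⟨C, hC⟩ := ((hF.pow i).mul (hG.pow j)).mono
        (show (i : ℝ) * 1 + j * 1 ≤ ((A + J : ℕ) : ℝ) by push_cast; linarith)
      have hC' := GrowthLE.coeff_le hC
      simp only [Real.rpow_natCast] at hC'
      exact ⟨C, by simpa using (Nat.cast_nonneg _).trans (hC' 0), fun _ _ => hC'⟩
    · exact ⟨0, le_rfl, fun h1 h2 => absurd ⟨h1, h2⟩ hij⟩
  choose C hC0 hC using h
  set B : (IntermediateField.adjoin ℚ {β} →ₐ[ℚ] ℂ) → ℝ := fun σ =>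
    ∑ i ∈ range (A + 1), ∑ j ∈ range (J + 1), ‖σ (c i j)‖ * C i j with hB
  have hB0 : ∀ σ, 0 ≤ B σ := fun σ =>
    sum_nonneg fun i _ => sum_nonneg fun j _ => mul_nonneg (norm_nonneg _) (hC0 i j)
  -- There are finitely many embeddings, so summing over them makes the constant uniform.
  refine ⟨∑ σ, B σ, fun σ m => ?_⟩
  have h1 : B σ ≤ ∑ σ, B σ := single_le_sum (fun σ _ => hB0 σ) (mem_univ σ)
  have h2 : ‖σ (combCoeff c A J F G m)‖ ≤ B σ * ((m : ℝ) + 1) ^ (A + J) := by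
    rw [combCoeff, map_sum, hB, sum_mul]
    refine norm_sum_le_of_le _ fun i hi => ?_
    rw [map_sum, sum_mul]
    refine norm_sum_le_of_le _ fun j hj => ?_
    rw [mem_range] at hi hj
    rw [map_mul, norm_mul, map_natCast, Complex.norm_natCast, mul_assoc]
    exact mul_le_mul_of_nonneg_left (hC i j (by omega) (by omega) m) (norm_nonneg _)
  exact h2.trans (by gcongr)

variable {A : ℕ} {ρ : ℝ} {t : ℕ → ℕ}

theorem false_of_integral_relation (hβ : IsPisot β ∨ IsSalem β) (hA : 1 ≤ A) (hρ : 1 < ρ)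
    (hAρ : (A : ℝ) * ρ⁻¹ < 1) (hAρ' : ((A : ℝ) - 1) * ρ⁻¹ + (1 - ρ⁻¹) ^ A < 1)
    (ht : IsLacunary t) (ht0 : t 0 = 0) {h J : ℕ} (hh : 1 ≤ h) (hhJ : h ≤ J)
    {c : ℕ → ℕ → IntermediateField.adjoin ℚ {β}} (hint : ∀ i j, IsIntegral ℤ (c i j))
    (hc : c A h ≠ 0) (hc' : ∀ j, h < j → c A j = 0)
    (hrel : ∑ i ∈ range (A + 1), ∑ j ∈ range (J + 1),
      (c i j : ℝ) * (gammaSeries ρ β⁻¹ ^ i * (∑' m, β⁻¹ ^ t m) ^ j) = 0) : False := by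
  have := finiteDimensional_adjoin (isIntegral_of_isPisot_or_isSalem hβ)
  have hβ1 := one_lt_of_isPisot_or_isSalem hβ
  have hβi : 0 ≤ β⁻¹ := by positivity
  have hβi1 : β⁻¹ < 1 := inv_lt_one_of_one_lt₀ hβ1
  set s : ℕ → ℕ := fun m => ⌊(m : ℝ) ^ ρ⌋₊ with hs
  have hs0 : s 0 = 0 := by simp [hs, Real.zero_rpow (by linarith : ρ ≠ 0)]
  have hst : Tendsto s atTop atTop := tendsto_floor_rpow hρ.le
  set F := countSeries s with hFdef
  set G := countSeries t with hGdef
  have hF0 : PowerSeries.coeff 0 F ≠ 0 := by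
    have := coeff_countSeries_ne_zero hst 0
    rwa [hs0] at this
  have hG0 : PowerSeries.coeff 0 G ≠ 0 := by
    have := coeff_countSeries_ne_zero ht.tendsto 0
    rwa [ht0] at this
  have hFg : GrowthLE F ρ⁻¹ := growthLE_floor_rpow hρ
  have hFv : HasValue F β⁻¹ (gammaSeries ρ β⁻¹) := hasValue_countSeries hst
    (summable_pow_of_eventually_le (Eventually.of_forall (le_floor_rpow hρ.le)) hβi hβi1)
  have hGv : HasValue G β⁻¹ (∑' m, β⁻¹ ^ t m) := hasValue_countSeries ht.tendsto
    (summable_pow_of_eventually_le ht.eventually_le hβi hβi1)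
  set a := combCoeff c A J F G with ha
  have hcoe : ∀ m, (a m : ℝ) = combCoeff (fun i j => (c i j : ℝ)) A J F G m := by
    intro m
    simp only [ha, combCoeff]
    push_cast
    rfl
  have hsum : HasSum (fun m => (a m : ℝ) * β⁻¹ ^ m) 0 := by
    rw [← hrel]
    simp only [hcoe]
    exact hasSum_combCoeff _ A J hFv hGv
  have haint : ∀ m, IsIntegral ℤ (a m) := fun m =>
    IsIntegral.sum _ fun i _ => IsIntegral.sum _ fun j _ => (hint i j).mul (isIntegral_natCast _)
  obtain ⟨C, hC⟩ := exists_norm_combCoeff_le c A J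
    (hFg.mono (inv_le_one_of_one_le₀ hρ.le)) (ht.growthLE one_pos)
  obtain ⟨D, k, hD, hbounds⟩ := exists_scaledSum_bounds hβ haint hC hsum
  obtain ⟨P, L₀, hnear⟩ := ht.exists_near
  refine false_of_scaled_bounds (J := J) hA hh hF0 hG0 (by positivity : 0 < ρ⁻¹) hAρ hAρ' hFg
    (fun ε hε => ht.growthLE hε) (by positivity) (exists_floor_rpow_near hρ) hnear hβ1
    (scaledSum_succ β _) hD (fun n => (hbounds n).1) (fun n => (hbounds n).2)
    (c := (c A h : ℝ)) (by simpa using hc) ?_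
  intro m h1 h2
  rw [ha, combCoeff_eq_single hhJ hF0 hG0 hc' h1 h2]
  push_cast
  rfl

-- The outer variable stands for γ and the inner one for the lacunary value. A relation is
-- normalised so that the counting argument applies to it.
open Polynomial in
theorem eval₂_ne_zero_of_isLacunary (hβ : IsPisot β ∨ IsSalem β) (hA : 1 ≤ A) (hρ : 1 < ρ)
    (hAρ : (A : ℝ) * ρ⁻¹ < 1) (hAρ' : ((A : ℝ) - 1) * ρ⁻¹ + (1 - ρ⁻¹) ^ A < 1)
    (ht : IsLacunary t) (ht0 : t 0 = 0) {p : (IntermediateField.adjoin ℚ {β})[X][X]} (hp : p ≠ 0)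
    (hpA : p.natDegree ≤ A) :
    p.eval₂ (aeval (∑' m, β⁻¹ ^ t m) : (IntermediateField.adjoin ℚ {β})[X] →ₐ[_] ℝ).toRingHom
      (gammaSeries ρ β⁻¹) ≠ 0 := by
  intro h0
  have := finiteDimensional_adjoin (isIntegral_of_isPisot_or_isSalem hβ)
  set η := ∑' m, β⁻¹ ^ t m with hη
  set γ := gammaSeries ρ β⁻¹ with hγ
  set φ := (aeval η : (IntermediateField.adjoin ℚ {β})[X] →ₐ[_] ℝ).toRingHom with hφ
  -- The power of the outer variable raises the degree to exactly A; the factor `C X` makes the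
  -- leading coefficient of positive degree, so that h ≥ 1 and G^(h-1) makes sense.
  set q : (IntermediateField.adjoin ℚ {β})[X][X] := X ^ (A - p.natDegree) * (C X * p) with hq
  have hCp : (C X : (IntermediateField.adjoin ℚ {β})[X][X]) * p ≠ 0 :=
    mul_ne_zero (C_ne_zero.mpr X_ne_zero) hp
  have hqA : q.coeff A = X * p.leadingCoeff := by
    have h1 := coeff_X_pow_mul (C X * p) (A - p.natDegree) p.natDegree
    rw [Nat.add_sub_cancel' hpA, coeff_C_mul] at h1
    exact h1
  have hqdeg : q.natDegree ≤ A := by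
    rw [hq, natDegree_mul (pow_ne_zero _ X_ne_zero) hCp, natDegree_X_pow,
      natDegree_C_mul X_ne_zero]
    omega
  have hq0 : q.eval₂ φ γ = 0 := by
    rw [hq, eval₂_mul, eval₂_mul, h0, mul_zero, mul_zero]
  set h := (q.coeff A).natDegree with hh
  have hqA0 : q.coeff A ≠ 0 := by
    rw [hqA]
    exact mul_ne_zero X_ne_zero (leadingCoeff_ne_zero.mpr hp)
  have hh1 : 1 ≤ h := by
    rw [hh, hqA, natDegree_mul X_ne_zero (leadingCoeff_ne_zero.mpr hp), natDegree_X]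
    omega
  set J := (range (A + 1)).sup fun i => (q.coeff i).natDegree with hJ
  have hJle : ∀ i ≤ A, (q.coeff i).natDegree ≤ J := fun i hi =>
    le_sup (f := fun i => (q.coeff i).natDegree) (mem_range.mpr (by omega))
  obtain ⟨d, hd0, hd⟩ := exists_integral_multiples ℤ ℚ
    ((range (A + 1) ×ˢ range (J + 1)).image fun k => (q.coeff k.1).coeff k.2)
  refine false_of_integral_relation hβ hA hρ hAρ hAρ' ht ht0 hh1 (hJle A le_rfl)
    (c := fun i j => d • (q.coeff i).coeff j) ?_ ?_ ?_ ?_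
  · intro i j
    by_cases hij : i ≤ A ∧ j ≤ J
    · exact hd _ (mem_image.mpr ⟨(i, j), by simp; omega, rfl⟩)
    · have hz : (q.coeff i).coeff j = 0 := by
        rw [not_and_or, not_le, not_le] at hij
        by_cases hi : i ≤ A
        · exact coeff_eq_zero_of_natDegree_lt ((hJle i hi).trans_lt (hij.resolve_left (by omega)))
        · rw [coeff_eq_zero_of_natDegree_lt (p := q) (n := i) (by omega), coeff_zero]
      rw [hz, smul_zero]
      exact isIntegral_zero
  · exact smul_ne_zero hd0 (leadingCoeff_ne_zero.mpr hqA0)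
  · intro j hj
    rw [coeff_eq_zero_of_natDegree_lt hj, smul_zero]
  · rw [eval₂_eq_sum_range' φ (Nat.lt_succ_of_le hqdeg)] at hq0
    have h1 : ∀ i ∈ range (A + 1), ∑ j ∈ range (J + 1),
        ((d • (q.coeff i).coeff j : IntermediateField.adjoin ℚ {β}) : ℝ) * (γ ^ i * η ^ j) =
        d * (φ (q.coeff i) * γ ^ i) := by
      intro i hi
      have h2 : φ (q.coeff i) =
          ∑ j ∈ range (J + 1), (((q.coeff i).coeff j : _) : ℝ) * η ^ j := by
        have h3 : φ (q.coeff i) = aeval η (q.coeff i) := rfl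
        rw [h3, aeval_eq_sum_range' (Nat.lt_succ_of_le (hJle i (by rw [mem_range] at hi; omega)))]
        rfl
      rw [h2, sum_mul, mul_sum]
      refine sum_congr rfl fun j _ => ?_
      rw [zsmul_eq_mul]
      push_cast
      ring
    rw [sum_congr rfl h1, ← mul_sum, hq0, mul_zero]

/-- A shift of η by an element e of ℚ(β) is an automorphism of the polynomial ring, so the value of
the series with the prepended exponent 0 may replace η. -/
theorem linearIndependent_pow_mul_pow (hβ : IsPisot β ∨ IsSalem β) (hA : 1 ≤ A) (hρ : 1 < ρ)
    (hAρ : (A : ℝ) * ρ⁻¹ < 1) (hAρ' : ((A : ℝ) - 1) * ρ⁻¹ + (1 - ρ⁻¹) ^ A < 1)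
    (ht : IsLacunary t) (ht0 : t 0 = 0) {η : ℝ} {e : IntermediateField.adjoin ℚ {β}}
    (hη : ∑' m, β⁻¹ ^ t m = e + η) :
    LinearIndependent (IntermediateField.adjoin ℚ {β})
      (fun k : {k : ℕ × ℕ // k.1 ≤ A} => gammaSeries ρ β⁻¹ ^ k.1.1 * η ^ k.1.2) := by
  classical
  rw [linearIndependent_iff]
  intro g hg
  open Polynomial in
  by_contra hne
  set p : (IntermediateField.adjoin ℚ {β})[X][X] :=
    ∑ k ∈ g.support, monomial k.1.1 (monomial k.1.2 (g k)) with hp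
  have hp0 : p ≠ 0 := by
    obtain ⟨k, hk⟩ := Finsupp.ne_iff.mp hne
    intro h0
    apply hk
    have h1 : (p.coeff k.1.1).coeff k.1.2 = g k := by
      rw [hp, finsetSum_coeff, finsetSum_coeff, sum_eq_single k]
      · simp
      · intro k' _ hkk
        rw [coeff_monomial]
        split_ifs with h1
        · rw [coeff_monomial, if_neg]
          exact fun h2 => hkk (Subtype.ext (Prod.ext h1 h2))
        · simp
      · intro hk'
        simp [Finsupp.notMem_support_iff.mp hk']
    rw [← h1, h0]
    simp
  set f := (compRingHom (X - C e) : (IntermediateField.adjoin ℚ {β})[X] →+* _) with hf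
  have hfinj : Function.Injective f := by
    intro u v huv
    have h1 : (u.comp (X - C e)).comp (X + C e) = (v.comp (X - C e)).comp (X + C e) :=
      congrArg (fun w => w.comp (X + C e)) huv
    simpa [comp_assoc] using h1
  have hpdeg : p.natDegree ≤ A :=
    natDegree_sum_le_of_forall_le _ _ fun k _ => (natDegree_monomial_le _).trans k.2
  refine eval₂_ne_zero_of_isLacunary hβ hA hρ hAρ hAρ' ht ht0
    (p := p.map f) ((Polynomial.map_ne_zero_iff hfinj).mpr hp0) (natDegree_map_le.trans hpdeg) ?_
  rw [eval₂_map]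
  have hcomp : ∀ u, ((aeval (∑' m, β⁻¹ ^ t m) :
      (IntermediateField.adjoin ℚ {β})[X] →ₐ[_] ℝ).toRingHom.comp f) u = aeval η u := by
    intro u
    have h1 : ((aeval (∑' m, β⁻¹ ^ t m) :
      (IntermediateField.adjoin ℚ {β})[X] →ₐ[_] ℝ).toRingHom.comp f) u =
        aeval (∑' m, β⁻¹ ^ t m) (u.comp (X - C e)) := rfl
    rw [h1, aeval_comp, hη]
    congr 2
    simp
  rw [hp, eval₂_finsetSum, ← hg, Finsupp.linearCombination_apply, Finsupp.sum]
  refine sum_congr rfl fun k _ => ?_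
  rw [eval₂_monomial, hcomp, aeval_monomial, Algebra.smul_def]
  ring

end Relation

end LacunaryValues

theorem mainTheorem8 (A : ℕ) (hA : 1 ≤ A) (ρ : ℝ)
    (hρ_small : A ≤ 3 → (A : ℝ) < ρ)
    (hρ_large : 4 ≤ A → (LacunaryValues.sigma A)⁻¹ < ρ) :
    (∀ y : ℝ, 1 < y → ∀ β : ℝ, LacunaryValues.IsPisot β ∨ LacunaryValues.IsSalem β →
      LinearIndependent (IntermediateField.adjoin ℚ {β})
        (fun k : {k : ℕ × ℕ // k.1 ≤ A} =>
          LacunaryValues.gammaSeries ρ β⁻¹ ^ k.1.1 *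
            LacunaryValues.lacunarySeries y β⁻¹ ^ k.1.2)) ∧
    (∀ y z : ℝ, (y, z) ∈ LacunaryValues.Theta →
      ∀ β : ℝ, LacunaryValues.IsPisot β ∨ LacunaryValues.IsSalem β →
      LinearIndependent (IntermediateField.adjoin ℚ {β})
        (fun k : {k : ℕ × ℕ // k.1 ≤ A} =>
          LacunaryValues.gammaSeries ρ β⁻¹ ^ k.1.1 *
            LacunaryValues.xiSeries y z β⁻¹ ^ k.1.2)) := by
  obtain ⟨hρ, hAρ, hAρ'⟩ := LacunaryValues.exponent_conditions hA hρ_small hρ_large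
  refine ⟨fun y hy β hβ => ?_, fun y z hyz β hβ => ?_⟩
  · have hβ1 := LacunaryValues.one_lt_of_isPisot_or_isSalem hβ
    have hu := LacunaryValues.isLacunary_floor_pow hy
    refine LacunaryValues.linearIndependent_pow_mul_pow hβ hA hρ hAρ hAρ'
      -- The given series has no exponent 0, since ⌊y^m⌋ ≥ 1; prepending it adds 1 to the value.
      (LacunaryValues.IsLacunary.consZero_isLacunary hu) rfl (e := 1) ?_
    rw [LacunaryValues.IsLacunary.tsum_consZero hu (by positivity) (inv_lt_one_of_one_lt₀ hβ1)]
    simp [LacunaryValues.lacunarySeries]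
  · have hβ1 := LacunaryValues.one_lt_of_isPisot_or_isSalem hβ
    have hu := LacunaryValues.isLacunary_floor_phi hyz
    refine LacunaryValues.linearIndependent_pow_mul_pow hβ hA hρ hAρ hAρ'
      -- Here the prepended exponent is the leading 1 of ξ, so no shift is needed.
      (LacunaryValues.IsLacunary.consZero_isLacunary hu) rfl (e := 0) ?_
    rw [LacunaryValues.IsLacunary.tsum_consZero hu (by positivity) (inv_lt_one_of_one_lt₀ hβ1)]
    simp [LacunaryValues.xiSeries]
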